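/- Let $q,a,b,c,d\in\mathbb C$ with $0<|q|<1$, $a\neq0$ and $abcd\,q^m\ne 1$ for all integers $m\ge 0$. Write $(x;q)_n=\prod_{k=0}^{n-1}(1-xq^k)$, $(x;q)_\infty=\prod_{k\ge0}(1-xq^k)$, and $(x_1,\dots,x_s;q)_n=\prod_{r=1}^s(x_r;q)_n$ for $0\le n\le\infty$. Let $$h_0=\frac{(abcd;q)_\infty}{(q,ab,ac,ad,bc,bd,cd;q)_\infty},\qquad w\Big(\frac{z+z^{-1}}2\Big)=\frac{(z^2,z^{-2};q)_\infty}{h_0\,(az,a/z,bz,b/z,cz,c/z,dz,d/z;q)_\infty}$$ be the Askey–Wilson weight. Let $C$ be a piecewise $C^1$ closed path in $\mathbb C\setminus\{0\}$ which passes through none of the points $eq^k$, $(eq^k)^{-1}$ ($e\in\{a,b,c,d\}$, $k\ge 0$; for $e=0$ there is no point $(eq^k)^{-1}$), has winding number $1$ about $0$ and about every point $eq^k$, and has winding number $0$ about every point $(eq^k)^{-1}$. (If $|a|,|b|,|c|,|d|<1$, the positively oriented unit circle is such a path.) Then the Askey–Wilson moments $$\mu_n=\oint_C \Big(\frac{z+z^{-1}}2\Big)^n\,w\Big(\frac{z+z^{-1}}2\Big)\,\frac{dz}{4\pi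 i z},\qquad n\ge 0,$$ are given by $$\mu_n=\frac1{2^n}\sum_{k=0}^n\frac{(ab,ac,ad;q)_k}{(abcd;q)_k}\,q^k\sum_{j=0}^k q^{-j^2}a^{-2j}\,\frac{(q^ja+q^{-j}/a)^n}{(q,q^{1-2j}/a^2;q)_j\,(q,q^{2j+1}a^2;q)_{k-j}}.$$ More generally, for every $n\ge0$ and every polynomial $p$ with complex coefficients of degree at most $n$, $$\oint_C p\Big(\frac{z+z^{-1}}2\Big)\,w\Big(\frac{z+z^{-1}}2\Big)\,\frac{dz}{4\pi i z}=\sum_{k=0}^n\frac{(ab,ac,ad;q)_k}{(abcd;q)_k}\,q^k\sum_{j=0}^k q^{-j^2}a^{-2j}\,\frac{p\big(\tfrac{q^ja+q^{-j}/a}2\big)}{(q,q^{1-2j}/a^2;q)_j\,(q,q^{2j+1}a^2;q)_{k-j}}.$$ -/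

import Mathlib

open scoped Polynomial

/-- The finite `q`-shifted factorial `(a;q)_n = ∏_{k=0}^{n-1} (1 - a q^k)`. -/
noncomputable def qPoch (q a : ℂ) (n : ℕ) : ℂ :=
  ∏ k ∈ Finset.range n, (1 - a * q ^ k)

/-- The infinite `q`-shifted factorial `(a;q)_∞ = ∏_{k ≥ 0} (1 - a q^k)`
(the product converges absolutely for `|q| < 1`). -/
noncomputable def qPochInf (q a : ℂ) : ℂ :=
  ∏' k : ℕ, (1 - a * q ^ k)

/-- `h₀(a,b,c,d,q) = (abcd;q)_∞ / (q,ab,ac,ad,bc,bd,cd;q)_∞`. -/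
noncomputable def awH0 (a b c d q : ℂ) : ℂ :=
  qPochInf q (a * b * c * d) /
    (qPochInf q q * qPochInf q (a * b) * qPochInf q (a * c) * qPochInf q (a * d) *
      qPochInf q (b * c) * qPochInf q (b * d) * qPochInf q (c * d))

/-- The Askey-Wilson weight `w(x)` in the variable `z = e^{iθ}`, where
`x = cos θ = (z + z⁻¹)/2`; the expression is invariant under `z ↦ z⁻¹`. -/
noncomputable def awWeight (a b c d q z : ℂ) : ℂ :=
  (qPochInf q (z ^ 2) * qPochInf q (z⁻¹ ^ 2)) /
    (awH0 a b c d q *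
      (qPochInf q (a * z) * qPochInf q (a * z⁻¹) * qPochInf q (b * z) * qPochInf q (b * z⁻¹) *
        qPochInf q (c * z) * qPochInf q (c * z⁻¹) * qPochInf q (d * z) * qPochInf q (d * z⁻¹)))

/-- `γ` restricted to `[0,1]` is a closed path along which one can integrate: it is continuous
and closed, and continuously differentiable outside finitely many parameters with an integrable
derivative. Every piecewise `C¹` closed path is of this kind. -/
structure IsClosedPath (γ : ℝ → ℂ) : Prop where
  continuousOn : ContinuousOn γ (Set.Icc 0 1)
  closed : γ 0 = γ 1
  piecewise : ∃ S : Set ℝ, S.Finite ∧ (∀ t ∈ Set.Ioo (0 : ℝ) 1 \ S, DifferentiableAt ℝ γ t) ∧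
    ContinuousOn (deriv γ) (Set.Ioo (0 : ℝ) 1 \ S)
  integrable : IntervalIntegrable (deriv γ) MeasureTheory.volume 0 1

/-- The contour integral `∮_γ f(z) dz`. -/
noncomputable def contourIntegral (γ : ℝ → ℂ) (f : ℂ → ℂ) : ℂ :=
  ∫ t in (0 : ℝ)..1, f (γ t) * deriv γ t

/-- The winding number of `γ` about a point `w` off `γ`. -/
noncomputable def windingNum (γ : ℝ → ℂ) (w : ℂ) : ℂ :=
  (2 * (Real.pi : ℂ) * Complex.I)⁻¹ * contourIntegral γ (fun z => (z - w)⁻¹)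

/-- The points `a q^k`, `b q^k`, `c q^k`, `d q^k` (`k ≥ 0`). -/
def innerPoles (a b c d q : ℂ) : Set ℂ :=
  {w | ∃ k : ℕ, ∃ e ∈ ({a, b, c, d} : Set ℂ), w = e * q ^ k}

/-- The points `(a q^k)⁻¹`, `(b q^k)⁻¹`, `(c q^k)⁻¹`, `(d q^k)⁻¹` (`k ≥ 0`); a parameter which is
zero contributes none. -/
def outerPoles (a b c d q : ℂ) : Set ℂ :=
  {w | ∃ k : ℕ, ∃ e ∈ ({a, b, c, d} : Set ℂ), w * (e * q ^ k) = 1}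

/-- `γ` is a closed path which encloses (once, counterclockwise) the inner poles and their limit
point `0` and excludes the outer poles; in particular it meets none of these points. -/
structure IsAWContour (a b c d q : ℂ) (γ : ℝ → ℂ) : Prop where
  path : IsClosedPath γ
  avoids : ∀ t ∈ Set.Icc (0 : ℝ) 1,
    γ t ≠ 0 ∧ γ t ∉ innerPoles a b c d q ∧ γ t ∉ outerPoles a b c d q
  encloses_zero : windingNum γ 0 = 1
  encloses : ∀ w ∈ innerPoles a b c d q, windingNum γ w = 1
  excludes : ∀ w ∈ outerPoles a b c d q, windingNum γ w = 0

/-- The Askey-Wilson integral `∮_C f(x) w(x) dz / (4πiz)`, where `x = (z + z⁻¹)/2`. -/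
noncomputable def awIntegral (a b c d q : ℂ) (C : ℝ → ℂ) (f : ℂ → ℂ) : ℂ :=
  contourIntegral C (fun z =>
    f ((z + z⁻¹) / 2) * awWeight a b c d q z / (4 * (Real.pi : ℂ) * Complex.I * z))

/-- The `n`-th Askey-Wilson moment, computed along the contour `C`. -/
noncomputable def awMoment (a b c d q : ℂ) (C : ℝ → ℂ) (n : ℕ) : ℂ :=
  awIntegral a b c d q C (fun x => x ^ n)

/-!
Let `J(a,b,c,d)` be the integral of the weight without `h₀` against `dz / z`. The proof evaluates `J`
by moving the parameters, and obtains the moments by Newton interpolation.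

*Shifting a parameter.* There is an explicit function `G` (`awPotential`) such that
`q G(qz) - G(z)` equals `1 / z` times the weight times a linear polynomial in `z + 1 / z`
(`awPotential_sub`). The paths `C` and `q C` have the same winding numbers around all poles of `G`, so
Cauchy's theorem makes the integral of the difference vanish (`contourIntegral_awPotential`). Since
`(1 - az)(1 - a/z)` times the weight is the weight for `aq`, this relation reads
`(1 - abcd) J(aq,b,c,d) = (1 - ab)(1 - ac)(1 - ad) J(a,b,c,d)`, and its iteration gives
`(abcd;q)_k J(aq^k,b,c,d) = (ab,ac,ad;q)_k J(a,b,c,d)` (`awTotal_shift`).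

*Cauchy's theorem.* The homological form that is needed is proved for rational functions by partial
fractions (`IsRationalOff.contourIntegral_eq`). It passes to infinite products because the finite
products `(x;q)_n` and their reciprocals are bounded on compact sets uniformly in `n`.

*Total mass.* Letting `k → ∞` replaces a parameter by `0`, so `J(a,b,c,d)` is a quotient of infinite
products times `J(0,0,0,0)` (`awTotal_mul_eq_awTotal_zero`). The latter depends only on the winding
number around `0`. It is found on the unit circle from the parameters `q, -q, s, -s` with `s² = q`, for which
the weight is the Laurent polynomial `(1 - z²)(1 - z⁻²)` (`qPochInf_mul_awTotal_zero`).

*Moments.* With `x_j = (a q^j + a⁻¹ q^(-j)) / 2` and `x = (z + 1/z) / 2` the product `(az, a/z;q)_k` is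
a constant times `∏_{i<k} (x - x_i)`, and its integral is known by the shift. Expanding a
polynomial by Newton's formula at the nodes `x_j` yields the double sum; the nodes are distinct
because no inner pole `a q^i` is an outer pole `(a q^j)⁻¹`.
-/

/-! ### The `q`-shifted factorials -/

section QPoch

open Filter Topology

variable {q : ℂ}

@[simp] lemma qPoch_zero_right (q x : ℂ) : qPoch q x 0 = 1 := by simp [qPoch]

@[simp] lemma qPochInf_zero (q : ℂ) : qPochInf q 0 = 1 := by simp [qPochInf]

lemma qPoch_succ (q x : ℂ) (n : ℕ) : qPoch q x (n + 1) = qPoch q x n * (1 - x * q ^ n) :=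
  Finset.prod_range_succ _ _

lemma qPoch_ne_zero {x : ℂ} (h : ∀ k : ℕ, x * q ^ k ≠ 1) (n : ℕ) : qPoch q x n ≠ 0 :=
  Finset.prod_ne_zero_iff.2 fun k _ => sub_ne_zero.2 (h k).symm

lemma summable_norm_mul_pow (hq : ‖q‖ < 1) (x : ℂ) : Summable fun k : ℕ => ‖-(x * q ^ k)‖ := by
  simp only [norm_neg, norm_mul, norm_pow]
  exact (summable_geometric_of_lt_one (norm_nonneg _) hq).mul_left _

lemma multipliable_one_sub_mul_pow (hq : ‖q‖ < 1) (x : ℂ) :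
    Multipliable fun k : ℕ => 1 - x * q ^ k := by
  simpa [sub_eq_add_neg] using multipliable_one_add_of_summable (summable_norm_mul_pow hq x)

lemma tendsto_qPoch (hq : ‖q‖ < 1) (x : ℂ) :
    Tendsto (fun n => qPoch q x n) atTop (𝓝 (qPochInf q x)) :=
  (multipliable_one_sub_mul_pow hq x).hasProd.tendsto_prod_nat

lemma qPochInf_eq_mul (hq : ‖q‖ < 1) (x : ℂ) (n : ℕ) :
    qPochInf q x = qPoch q x n * qPochInf q (x * q ^ n) := by
  refine tendsto_nhds_unique ((tendsto_add_atTop_iff_nat n).2 (tendsto_qPoch hq x))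
    (((tendsto_qPoch hq (x * q ^ n)).const_mul (qPoch q x n)).congr fun m => ?_)
  rw [add_comm m n, qPoch, qPoch, qPoch, Finset.prod_range_add]
  congr 1
  exact Finset.prod_congr rfl fun k _ => by ring

lemma qPochInf_eq_one_sub_mul (hq : ‖q‖ < 1) (x : ℂ) :
    qPochInf q x = (1 - x) * qPochInf q (x * q) := by
  simpa [qPoch] using qPochInf_eq_mul hq x 1

lemma qPochInf_ne_zero (hq : ‖q‖ < 1) {x : ℂ} (h : ∀ k : ℕ, x * q ^ k ≠ 1) :
    qPochInf q x ≠ 0 := by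
  have := tprod_one_add_ne_zero_of_summable (f := fun k : ℕ => -(x * q ^ k))
    (fun k => by rw [← sub_eq_add_neg]; exact sub_ne_zero.2 (h k).symm)
    (summable_norm_mul_pow hq x)
  simpa [qPochInf, sub_eq_add_neg] using this

lemma qPochInf_ne_zero_of_norm_lt (hq : ‖q‖ < 1) {x : ℂ} (h : ‖x‖ < 1) : qPochInf q x ≠ 0 := by
  refine qPochInf_ne_zero hq fun k hk => ?_
  have h1 : ‖x‖ * ‖q‖ ^ k = 1 := by rw [← norm_pow, ← norm_mul, hk, norm_one]
  have h2 : ‖q‖ ^ k ≤ 1 := pow_le_one₀ (norm_nonneg _) hq.le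
  nlinarith [norm_nonneg x]

lemma continuous_qPochInf (hq : ‖q‖ < 1) : Continuous (qPochInf q) := by
  refine continuous_iff_continuousAt.2 fun x => ?_
  have hs : Summable fun k : ℕ => (‖x‖ + 1) * ‖q‖ ^ k :=
    (summable_geometric_of_lt_one (norm_nonneg _) hq).mul_left _
  have := tendsto_tprod_one_add_of_dominated_convergence (𝓕 := 𝓝 x)
    (f := fun y (k : ℕ) => -(y * q ^ k)) (g := fun k : ℕ => -(x * q ^ k)) hs
    (fun k => (Continuous.tendsto (by fun_prop) x)) ?_
  · have e : qPochInf q = fun y => ∏' k : ℕ, (1 + -(y * q ^ k)) := by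
      funext y; simp only [qPochInf, sub_eq_add_neg]
    rw [ContinuousAt, e]
    exact this
  · filter_upwards [Metric.ball_mem_nhds x one_pos] with y hy k
    rw [norm_neg, norm_mul, norm_pow]
    gcongr
    have := norm_sub_norm_le y x
    rw [mem_ball_iff_norm] at hy
    linarith

lemma norm_qPoch_le (hq : ‖q‖ < 1) (x : ℂ) (n : ℕ) :
    ‖qPoch q x n‖ ≤ Real.exp (‖x‖ * (1 - ‖q‖)⁻¹) := by
  calc ‖qPoch q x n‖ = ∏ k ∈ Finset.range n, ‖1 - x * q ^ k‖ := norm_prod _ _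
    _ ≤ ∏ k ∈ Finset.range n, Real.exp (‖x‖ * ‖q‖ ^ k) := by
        refine Finset.prod_le_prod (fun _ _ => norm_nonneg _) fun k _ => ?_
        refine (norm_sub_le _ _).trans ?_
        rw [norm_one, norm_mul, norm_pow, add_comm]
        exact Real.add_one_le_exp _
    _ = Real.exp (‖x‖ * ∑ k ∈ Finset.range n, ‖q‖ ^ k) := by
        rw [← Real.exp_sum, Finset.mul_sum]
    _ ≤ _ := by
        gcongr
        rw [← tsum_geometric_of_lt_one (norm_nonneg _) hq]
        exact (summable_geometric_of_lt_one (norm_nonneg _) hq).sum_le_tsum _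
          fun _ _ => by positivity

lemma norm_qPochInf_le (hq : ‖q‖ < 1) (x : ℂ) :
    ‖qPochInf q x‖ ≤ Real.exp (‖x‖ * (1 - ‖q‖)⁻¹) :=
  le_of_tendsto (tendsto_qPoch hq x).norm (.of_forall fun n => norm_qPoch_le hq x n)

/-- On a compact set the finite products `(g z;q)_n` are bounded uniformly in `n`. -/
lemma exists_norm_qPoch_le (hq : ‖q‖ < 1) {K : Set ℂ} (hK : IsCompact K) {g : ℂ → ℂ}
    (hg : ContinuousOn g K) : ∃ M, ∀ z ∈ K, ∀ n, ‖qPoch q (g z) n‖ ≤ M := by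
  obtain ⟨R, hR⟩ := hK.exists_bound_of_continuousOn hg
  refine ⟨Real.exp (R * (1 - ‖q‖)⁻¹), fun z hz n => (norm_qPoch_le hq _ n).trans ?_⟩
  have : 0 < 1 - ‖q‖ := by linarith
  gcongr
  exact hR z hz

/-- On a compact set where `(g z;q)_∞` has no zero, the reciprocals of `(g z;q)_n` are bounded
uniformly in `n`, since `1 / (x;q)_n = (x q^n;q)_∞ / (x;q)_∞`. -/
lemma exists_norm_inv_qPoch_le (hq : ‖q‖ < 1) {K : Set ℂ} (hK : IsCompact K) {g : ℂ → ℂ}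
    (hg : ContinuousOn g K) (h0 : ∀ z ∈ K, ∀ k : ℕ, g z * q ^ k ≠ 1) :
    ∃ M, ∀ z ∈ K, ∀ n, ‖(qPoch q (g z) n)⁻¹‖ ≤ M := by
  obtain ⟨R, hR⟩ := hK.exists_bound_of_continuousOn hg
  obtain ⟨R', hR'⟩ := hK.exists_bound_of_continuousOn
    (((continuous_qPochInf hq).comp_continuousOn hg).inv₀ fun z hz => qPochInf_ne_zero hq (h0 z hz))
  refine ⟨Real.exp (R * (1 - ‖q‖)⁻¹) * R', fun z hz n => ?_⟩
  have h1 : (qPoch q (g z) n)⁻¹ = qPochInf q (g z * q ^ n) * (qPochInf q (g z))⁻¹ := by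
    have h2 := qPochInf_eq_mul hq (g z) n
    have h3 := qPochInf_ne_zero hq (h0 z hz)
    have h4 := qPoch_ne_zero (h0 z hz) n
    field_simp
    rw [h2]
  rw [h1, norm_mul]
  have : 0 < 1 - ‖q‖ := by linarith
  refine mul_le_mul ((norm_qPochInf_le hq _).trans ?_) (hR' z hz) (norm_nonneg _)
    (Real.exp_pos _).le
  gcongr
  rw [norm_mul, norm_pow]
  calc ‖g z‖ * ‖q‖ ^ n ≤ ‖g z‖ * 1 := by gcongr; exact pow_le_one₀ (norm_nonneg _) hq.le
    _ ≤ R := by simpa using hR z hz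

lemma norm_sq_lt_one (hq : ‖q‖ < 1) : ‖q ^ 2‖ < 1 := by
  rw [norm_pow]; exact pow_lt_one₀ (norm_nonneg _) hq two_ne_zero

lemma qPochInf_mul_qPochInf_neg (hq : ‖q‖ < 1) (x : ℂ) :
    qPochInf q x * qPochInf q (-x) = qPochInf (q ^ 2) (x ^ 2) := by
  refine tendsto_nhds_unique ((tendsto_qPoch hq x).mul (tendsto_qPoch hq (-x)))
    ((tendsto_qPoch (norm_sq_lt_one hq) (x ^ 2)).congr fun n => ?_)
  rw [qPoch, qPoch, qPoch, ← Finset.prod_mul_distrib]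
  exact Finset.prod_congr rfl fun k _ => by ring

lemma qPochInf_sq_mul (hq : ‖q‖ < 1) (x : ℂ) :
    qPochInf (q ^ 2) x * qPochInf (q ^ 2) (x * q) = qPochInf q x := by
  have e : ∀ k : ℕ, 1 - x * (q ^ 2) ^ k = 1 - x * q ^ (2 * k) := fun k => by ring
  have o : ∀ k : ℕ, 1 - x * q * (q ^ 2) ^ k = 1 - x * q ^ (2 * k + 1) := fun k => by ring
  have he := multipliable_one_sub_mul_pow (norm_sq_lt_one hq) x
  have ho := multipliable_one_sub_mul_pow (norm_sq_lt_one hq) (x * q)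
  simp only [e] at he
  simp only [o] at ho
  have := tprod_even_mul_odd (f := fun k => 1 - x * q ^ k) he ho
  simpa only [qPochInf, e, o] using this

end QPoch

/-! ### Contour integrals -/

section Contour

open Filter Topology MeasureTheory

variable {γ γ₁ γ₂ : ℝ → ℂ} {f g : ℂ → ℂ} {P : Set ℂ}

/-- The integrand of `contourIntegral γ f` is integrable. -/
def ContourIntegrable (γ : ℝ → ℂ) (f : ℂ → ℂ) : Prop :=
  IntervalIntegrable (fun t => f (γ t) * deriv γ t) volume 0 1

lemma contourIntegral_add (hf : ContourIntegrable γ f) (hg : ContourIntegrable γ g) :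
    contourIntegral γ (fun z => f z + g z) = contourIntegral γ f + contourIntegral γ g := by
  simp only [contourIntegral, add_mul]
  exact intervalIntegral.integral_add hf hg

lemma contourIntegral_const_mul (c : ℂ) :
    contourIntegral γ (fun z => c * f z) = c * contourIntegral γ f := by
  simp only [contourIntegral, mul_assoc]
  exact intervalIntegral.integral_const_mul _ _

lemma contourIntegral_sum {ι : Type*} (s : Finset ι) {F : ι → ℂ → ℂ}
    (hF : ∀ i ∈ s, ContourIntegrable γ (F i)) :
    contourIntegral γ (fun z => ∑ i ∈ s, F i z) = ∑ i ∈ s, contourIntegral γ (F i) := by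
  simp only [contourIntegral, Finset.sum_mul]
  exact intervalIntegral.integral_finsetSum hF

lemma contourIntegral_congr (h : ∀ t ∈ Set.Icc (0 : ℝ) 1, f (γ t) = g (γ t)) :
    contourIntegral γ f = contourIntegral γ g := by
  refine intervalIntegral.integral_congr fun t ht => ?_
  rw [Set.uIcc_of_le zero_le_one] at ht
  simp only [h t ht]

lemma IsClosedPath.isCompact_image (h : IsClosedPath γ) : IsCompact (γ '' Set.Icc 0 1) :=
  isCompact_Icc.image_of_continuousOn h.continuousOn

lemma IsClosedPath.contourIntegrable (h : IsClosedPath γ)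
    (hf : ContinuousOn f (γ '' Set.Icc 0 1)) : ContourIntegrable γ f := by
  refine h.integrable.continuousOn_mul ?_
  rw [Set.uIcc_of_le zero_le_one]
  exact hf.comp h.continuousOn (Set.mapsTo_image _ _)

lemma IsClosedPath.const_mul (h : IsClosedPath γ) (c : ℂ) :
    IsClosedPath fun t => c * γ t := by
  have hd : deriv (fun t => c * γ t) = fun t => c * deriv γ t := by
    ext t; exact deriv_const_mul_field c
  obtain ⟨S, hS, h1, h2⟩ := h.piecewise
  refine ⟨h.continuousOn.const_mul c |>.congr fun _ _ => rfl, by simp [h.closed],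
    ⟨S, hS, fun t ht => (h1 t ht).const_mul c, ?_⟩, ?_⟩
  · rw [hd]; exact continuousOn_const.mul h2
  · rw [hd]; exact h.integrable.const_mul c

lemma contourIntegral_comp_const_mul (c : ℂ) :
    contourIntegral (fun t => c * γ t) f = c * contourIntegral γ fun z => f (c * z) := by
  have hd : deriv (fun t => c * γ t) = fun t => c * deriv γ t := by
    ext t; exact deriv_const_mul_field c
  rw [← contourIntegral_const_mul]
  simp only [contourIntegral, hd]
  exact intervalIntegral.integral_congr fun t _ => by ring

lemma windingNum_const_mul {c : ℂ} (hc : c ≠ 0) (w : ℂ) :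
    windingNum (fun t => c * γ t) (c * w) = windingNum γ w := by
  rw [windingNum, windingNum, contourIntegral_comp_const_mul, ← contourIntegral_const_mul]
  congr 2
  ext z
  rw [← mul_sub, mul_inv, mul_inv_cancel_left₀ hc]

lemma contourIntegral_inv_sub (γ : ℝ → ℂ) (w : ℂ) :
    contourIntegral γ (fun z => (z - w)⁻¹) = 2 * (Real.pi : ℂ) * Complex.I * windingNum γ w := by
  rw [windingNum, mul_inv_cancel_left₀ Complex.two_pi_I_ne_zero]

/-- The integral along a closed path of a function with a primitive near the path vanishes. -/
lemma IsClosedPath.contourIntegral_eq_zero (h : IsClosedPath γ) {F : ℂ → ℂ}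
    (hf : ContinuousOn f (γ '' Set.Icc 0 1))
    (hF : ∀ z ∈ γ '' Set.Icc 0 1, HasDerivAt F (f z) z) : contourIntegral γ f = 0 := by
  obtain ⟨S, hS, h1, -⟩ := h.piecewise
  have key := integral_eq_of_hasDerivAt_off_countable (a := (0 : ℝ)) (b := 1)
    (fun t => F (γ t)) (fun t => f (γ t) * deriv γ t) hS.countable ?_ ?_
    (h.contourIntegrable hf)
  · rw [contourIntegral, key, h.closed, sub_self]
  · rw [Set.uIcc_of_le zero_le_one]
    exact ContinuousOn.comp (fun z hz => (hF z hz).continuousAt.continuousWithinAt)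
      h.continuousOn (Set.mapsTo_image _ _)
  · intro t ht
    rw [min_eq_left zero_le_one, max_eq_right zero_le_one] at ht
    exact (hF _ ⟨t, Set.Ioo_subset_Icc_self ht.1, rfl⟩).comp_of_eq t (h1 t ht).hasDerivAt rfl

/-- The continuous functions `F n` are uniformly bounded on `K` and tend to `f` pointwise there,
which is what passing to the limit under a contour integral needs. -/
structure BoundedlyTendsto (K : Set ℂ) (F : ℕ → ℂ → ℂ) (f : ℂ → ℂ) : Prop where
  continuousOn : ∀ n, ContinuousOn (F n) K
  continuousOn_lim : ContinuousOn f K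
  bounded : ∃ M, ∀ z ∈ K, ∀ n, ‖F n z‖ ≤ M
  tendsto : ∀ z ∈ K, Tendsto (fun n => F n z) atTop (𝓝 (f z))

namespace BoundedlyTendsto

variable {K : Set ℂ} {F G : ℕ → ℂ → ℂ}

lemma const (hK : IsCompact K) (hf : ContinuousOn f K) : BoundedlyTendsto K (fun _ => f) f where
  continuousOn _ := hf
  continuousOn_lim := hf
  bounded := by
    obtain ⟨M, hM⟩ := hK.exists_bound_of_continuousOn hf
    exact ⟨M, fun z hz _ => hM z hz⟩
  tendsto _ _ := tendsto_const_nhds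

lemma mul (hF : BoundedlyTendsto K F f) (hG : BoundedlyTendsto K G g) :
    BoundedlyTendsto K (fun n z => F n z * G n z) (fun z => f z * g z) where
  continuousOn n := (hF.continuousOn n).mul (hG.continuousOn n)
  continuousOn_lim := hF.continuousOn_lim.mul hG.continuousOn_lim
  bounded := by
    obtain ⟨M, hM⟩ := hF.bounded
    obtain ⟨N, hN⟩ := hG.bounded
    refine ⟨M * N, fun z hz n => ?_⟩
    rw [norm_mul]
    exact mul_le_mul (hM z hz n) (hN z hz n) (norm_nonneg _) ((norm_nonneg _).trans (hM z hz n))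
  tendsto z hz := (hF.tendsto z hz).mul (hG.tendsto z hz)

lemma qPoch {q : ℂ} (hq : ‖q‖ < 1) (hK : IsCompact K) (hg : ContinuousOn g K) :
    BoundedlyTendsto K (fun n z => qPoch q (g z) n) (fun z => qPochInf q (g z)) where
  continuousOn n := by
    simp only [_root_.qPoch]
    fun_prop
  continuousOn_lim := (continuous_qPochInf hq).comp_continuousOn hg
  bounded := exists_norm_qPoch_le hq hK hg
  tendsto z _ := tendsto_qPoch hq (g z)

lemma inv_qPoch {q : ℂ} (hq : ‖q‖ < 1) (hK : IsCompact K) (hg : ContinuousOn g K)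
    (h0 : ∀ z ∈ K, ∀ k : ℕ, g z * q ^ k ≠ 1) :
    BoundedlyTendsto K (fun n z => (_root_.qPoch q (g z) n)⁻¹) (fun z => (qPochInf q (g z))⁻¹) where
  continuousOn n :=
    ((BoundedlyTendsto.qPoch hq hK hg).continuousOn n).inv₀ fun z hz => qPoch_ne_zero (h0 z hz) n
  continuousOn_lim := ((continuous_qPochInf hq).comp_continuousOn hg).inv₀
    fun z hz => qPochInf_ne_zero hq (h0 z hz)
  bounded := exists_norm_inv_qPoch_le hq hK hg h0
  tendsto z hz := (tendsto_qPoch hq (g z)).inv₀ (qPochInf_ne_zero hq (h0 z hz))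

end BoundedlyTendsto

lemma IsClosedPath.tendsto_contourIntegral (h : IsClosedPath γ) {F : ℕ → ℂ → ℂ}
    (hF : BoundedlyTendsto (γ '' Set.Icc 0 1) F f) :
    Tendsto (fun n => contourIntegral γ (F n)) atTop (𝓝 (contourIntegral γ f)) := by
  obtain ⟨hc, -, ⟨M, hM⟩, hl⟩ := hF
  have hmem : ∀ t ∈ Set.uIoc (0 : ℝ) 1, γ t ∈ γ '' Set.Icc 0 1 := fun t ht => by
    rw [Set.uIoc_of_le zero_le_one] at ht
    exact ⟨t, Set.Ioc_subset_Icc_self ht, rfl⟩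
  refine intervalIntegral.tendsto_integral_filter_of_dominated_convergence
    (fun t => M * ‖deriv γ t‖) (.of_forall fun n => ?_) (.of_forall fun n => ?_)
    (h.integrable.norm.const_mul M) ?_
  · exact (intervalIntegrable_iff.1 (h.contourIntegrable (hc n))).aestronglyMeasurable
  · refine .of_forall fun t ht => ?_
    rw [norm_mul]
    gcongr
    exact hM _ (hmem t ht) n
  · exact .of_forall fun t ht => (hl _ (hmem t ht)).mul_const _

/-! ### Rational functions with prescribed poles -/

/-- `IsRationalOff P f`: outside `P`, the function `f` is a linear combination of monomials `z ^ m`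
and of the fractions `1 / (z - s) ^ m` with `s ∈ P`. The values of `f` on `P` are irrelevant. -/
inductive IsRationalOff (P : Set ℂ) : (ℂ → ℂ) → Prop
  | pow (m : ℕ) : IsRationalOff P fun z => z ^ m
  | pole (s : ℂ) (hs : s ∈ P) (m : ℕ) : IsRationalOff P fun z => (z - s)⁻¹ ^ m
  | add {f g : ℂ → ℂ} (hf : IsRationalOff P f) (hg : IsRationalOff P g) :
      IsRationalOff P fun z => f z + g z
  | const_mul (c : ℂ) {f : ℂ → ℂ} (hf : IsRationalOff P f) : IsRationalOff P fun z => c * f z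
  | congr {f g : ℂ → ℂ} (hf : IsRationalOff P f) (hfg : ∀ z ∉ P, f z = g z) : IsRationalOff P g

namespace IsRationalOff

lemma const (P : Set ℂ) (c : ℂ) : IsRationalOff P fun _ => c := by
  simpa using (pow (P := P) 0).const_mul c

lemma id_mul (hf : IsRationalOff P f) : IsRationalOff P fun z => z * f z := by
  induction hf with
  | pow m => exact (pow (m + 1)).congr fun z _ => by ring
  | pole s hs m =>
    cases m with
    | zero => exact (pow 1).congr fun z _ => by simp
    | succ m =>
      -- `z / (z - s) ^ (m + 1) = 1 / (z - s) ^ m + s / (z - s) ^ (m + 1)`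
      refine ((pole s hs m).add ((pole s hs (m + 1)).const_mul s)).congr fun z hz => ?_
      have : (z - s) * (z - s)⁻¹ = 1 := mul_inv_cancel₀ (sub_ne_zero.2 fun h => hz (h ▸ hs))
      linear_combination -(z - s)⁻¹ ^ m * this
  | add _ _ h1 h2 => exact (h1.add h2).congr fun z _ => by ring
  | const_mul c _ h => exact (h.const_mul c).congr fun z _ => by ring
  | congr _ h h1 => exact h1.congr fun z hz => by rw [h z hz]

lemma inv_sub_mul (hf : IsRationalOff P f) {t : ℂ} (ht : t ∈ P) :
    IsRationalOff P fun z => (z - t)⁻¹ * f z := by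
  induction hf with
  | pow m =>
    induction m with
    | zero => exact (pole t ht 1).congr fun z _ => by simp
    | succ m ih =>
      refine ((pow m).add (ih.const_mul t)).congr fun z hz => ?_
      have : z - t ≠ 0 := sub_ne_zero.2 fun h => hz (h ▸ ht)
      field_simp
      ring
  | pole s hs m =>
    rcases eq_or_ne s t with rfl | hst
    · exact (pole s hs (m + 1)).congr fun z _ => by ring
    · induction m with
      | zero => exact (pole t ht 1).congr fun z _ => by simp
      | succ m ih =>
        -- `1 / ((z - t) (z - s)) = (1 / (z - t) - 1 / (z - s)) / (t - s)`
        refine ((ih.add ((pole s hs (m + 1)).const_mul (-1))).const_mul (t - s)⁻¹).congr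
          fun z hz => ?_
        have h1 : z - t ≠ 0 := sub_ne_zero.2 fun h => hz (h ▸ ht)
        have h2 : z - s ≠ 0 := sub_ne_zero.2 fun h => hz (h ▸ hs)
        have h3 : t - s ≠ 0 := sub_ne_zero.2 hst.symm
        have h4 : (z - t)⁻¹ * (z - s)⁻¹ = (t - s)⁻¹ * ((z - t)⁻¹ - (z - s)⁻¹) := by
          field_simp
          ring
        linear_combination -(z - s)⁻¹ ^ m * h4
  | add _ _ h1 h2 => exact (h1.add h2).congr fun z _ => by ring
  | const_mul c _ h => exact (h.const_mul c).congr fun z _ => by ring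
  | congr _ h h1 => exact h1.congr fun z hz => by rw [h z hz]

lemma mul (hf : IsRationalOff P f) (hg : IsRationalOff P g) :
    IsRationalOff P fun z => f z * g z := by
  induction hf with
  | pow m =>
    induction m with
    | zero => simpa using hg
    | succ m ih => exact ih.id_mul.congr fun z _ => by ring
  | pole s hs m =>
    induction m with
    | zero => simpa using hg
    | succ m ih => exact (ih.inv_sub_mul hs).congr fun z _ => by ring
  | add _ _ h1 h2 => exact (h1.add h2).congr fun z _ => by ring
  | const_mul c _ h => exact (h.const_mul c).congr fun z _ => by ring
  | congr _ h h1 => exact h1.congr fun z hz => by rw [h z hz]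

lemma one_sub (hf : IsRationalOff P f) : IsRationalOff P fun z => 1 - f z :=
  ((const P 1).add (hf.const_mul (-1))).congr fun z _ => by ring

lemma prod {ι : Type*} {s : Finset ι} {F : ι → ℂ → ℂ} (hF : ∀ i ∈ s, IsRationalOff P (F i)) :
    IsRationalOff P fun z => ∏ i ∈ s, F i z := by
  classical
  induction s using Finset.induction_on with
  | empty => simpa using const P 1
  | insert i s hi ih =>
    simp only [Finset.prod_insert hi]
    exact (hF i (Finset.mem_insert_self _ _)).mul
      (ih fun j hj => hF j (Finset.mem_insert_of_mem hj))

lemma inv (h0 : (0 : ℂ) ∈ P) : IsRationalOff P fun z => z⁻¹ := by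
  simpa using pole (P := P) 0 h0 1

lemma qPoch (hf : IsRationalOff P f) (q : ℂ) (n : ℕ) : IsRationalOff P fun z => qPoch q (f z) n :=
  prod fun _ _ => ((hf.mul (const P _))).one_sub

lemma inv_one_sub_mul {e : ℂ} (h : ∀ w, w * e = 1 → w ∈ P) :
    IsRationalOff P fun z => (1 - e * z)⁻¹ := by
  rcases eq_or_ne e 0 with rfl | he
  · simpa using const P 1
  · refine ((pole e⁻¹ (h _ (inv_mul_cancel₀ he)) 1).const_mul (-e)⁻¹).congr fun z _ => ?_
    rw [pow_one, ← mul_inv]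
    congr 1
    field_simp
    ring

lemma inv_one_sub_mul_inv {e : ℂ} (h0 : (0 : ℂ) ∈ P) (h : e ∈ P) :
    IsRationalOff P fun z => (1 - e * z⁻¹)⁻¹ := by
  refine (pole e h 1).id_mul.congr fun z hz => ?_
  have h1 : z ≠ 0 := fun h => hz (h ▸ h0)
  have h2 : z - e ≠ 0 := sub_ne_zero.2 fun h' => hz (h' ▸ h)
  have h3 : 1 - e * z⁻¹ = (z - e) / z := by field_simp
  rw [h3, pow_one, inv_div, div_eq_mul_inv]

lemma inv_qPoch_mul {q e : ℂ} (h : ∀ (k : ℕ) (w : ℂ), w * (e * q ^ k) = 1 → w ∈ P) (n : ℕ) :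
    IsRationalOff P fun z => (_root_.qPoch q (e * z) n)⁻¹ := by
  simp only [_root_.qPoch, ← Finset.prod_inv_distrib]
  refine prod fun k _ => (inv_one_sub_mul (h k)).congr fun z _ => by congr 1; ring

lemma inv_qPoch_mul_inv {q e : ℂ} (h0 : (0 : ℂ) ∈ P) (h : ∀ k : ℕ, e * q ^ k ∈ P) (n : ℕ) :
    IsRationalOff P fun z => (_root_.qPoch q (e * z⁻¹) n)⁻¹ := by
  simp only [_root_.qPoch, ← Finset.prod_inv_distrib]
  refine prod fun k _ => (inv_one_sub_mul_inv h0 (h k)).congr fun z _ => by congr 1; ring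

lemma continuousOn (hf : IsRationalOff P f) : ContinuousOn f Pᶜ := by
  induction hf with
  | pow m => fun_prop
  | pole s hs m =>
    have hz : ∀ z ∈ Pᶜ, z - s ≠ 0 := fun z hz => sub_ne_zero.2 fun h => hz (h ▸ hs)
    exact (ContinuousOn.inv₀ (by fun_prop) hz).pow m
  | add _ _ h1 h2 => exact h1.add h2
  | const_mul c _ h => exact continuousOn_const.mul h
  | congr _ h h1 => exact h1.congr fun z hz => (h z hz).symm

/-- Cauchy's theorem for rational functions: two closed paths which avoid the poles and wind
equally often around each of them give the same integral. -/
theorem contourIntegral_eq (hf : IsRationalOff P f) (h₁ : IsClosedPath γ₁) (h₂ : IsClosedPath γ₂)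
    (ha₁ : ∀ z ∈ γ₁ '' Set.Icc 0 1, z ∉ P) (ha₂ : ∀ z ∈ γ₂ '' Set.Icc 0 1, z ∉ P)
    (hw : ∀ s ∈ P, windingNum γ₁ s = windingNum γ₂ s) :
    contourIntegral γ₁ f = contourIntegral γ₂ f := by
  induction hf with
  | pow m =>
    have key : ∀ γ, IsClosedPath γ → contourIntegral γ (fun z => z ^ m) = 0 := fun γ h => by
      refine h.contourIntegral_eq_zero (F := fun z => z ^ (m + 1) / (m + 1)) (by fun_prop)
        fun z _ => ?_
      have := (hasDerivAt_pow (m + 1) z).div_const ((m : ℂ) + 1)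
      have hm : (m : ℂ) + 1 ≠ 0 := by exact_mod_cast m.succ_ne_zero
      refine this.congr_deriv ?_
      rw [Nat.add_sub_cancel, Nat.cast_add, Nat.cast_one, mul_div_cancel_left₀ _ hm]
    rw [key _ h₁, key _ h₂]
  | pole s hs m =>
    have key : ∀ m γ, IsClosedPath γ → (∀ z ∈ γ '' Set.Icc 0 1, z ∉ P) →
        contourIntegral γ (fun z => (z - s)⁻¹ ^ (m + 2)) = 0 := fun m γ h ha => by
      have hne : ∀ z ∈ γ '' Set.Icc 0 1, z - s ≠ 0 := fun z hz =>
        sub_ne_zero.2 fun h => ha z hz (h ▸ hs)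
      refine h.contourIntegral_eq_zero (F := fun z => (z - s)⁻¹ ^ (m + 1) / (-(m + 1)))
        ((pole s hs (m + 2)).continuousOn.mono ha) fun z hz => ?_
      have hz := hne z hz
      have := ((((hasDerivAt_id' z).sub_const s).inv hz).pow (m + 1)).div_const (-((m : ℂ) + 1))
      have hm : (m : ℂ) + 1 ≠ 0 := by exact_mod_cast m.succ_ne_zero
      refine this.congr_deriv ?_
      simp only [Pi.inv_apply, Nat.add_sub_cancel, Nat.cast_add, Nat.cast_one, inv_pow]
      field_simp
      rw [pow_add, mul_comm]
    have zero : ∀ γ, IsClosedPath γ → contourIntegral γ (fun z => (z - s)⁻¹ ^ 0) = 0 := fun γ h =>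
      h.contourIntegral_eq_zero (F := fun z => z) (by simp only [pow_zero]; fun_prop)
        fun z _ => by simpa using hasDerivAt_id' z
    match m with
    | 0 => rw [zero _ h₁, zero _ h₂]
    | 1 => simp only [pow_one, contourIntegral_inv_sub, hw s hs]
    | m + 2 => rw [key m _ h₁ ha₁, key m _ h₂ ha₂]
  | add hf hg i1 i2 =>
    rw [contourIntegral_add (h₁.contourIntegrable (hf.continuousOn.mono ha₁))
        (h₁.contourIntegrable (hg.continuousOn.mono ha₁)),
      contourIntegral_add (h₂.contourIntegrable (hf.continuousOn.mono ha₂))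
        (h₂.contourIntegrable (hg.continuousOn.mono ha₂)), i1, i2]
  | const_mul c _ h => rw [contourIntegral_const_mul, contourIntegral_const_mul, h]
  | congr _ h i =>
    rw [contourIntegral_congr (γ := γ₁) (fun t ht => (h _ (ha₁ _ ⟨t, ht, rfl⟩)).symm),
      contourIntegral_congr (γ := γ₂) (fun t ht => (h _ (ha₂ _ ⟨t, ht, rfl⟩)).symm), i]

end IsRationalOff

end Contour

/-! ### Contours for shifted, permuted and vanishing parameters -/

section Params

variable {a b c d q : ℂ} {C : ℝ → ℂ}

/-- A contour for `a, b, c, d` serves all parameters which are zero or of the form `e q ^ k` with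
`e` among `a, b, c, d`: they have fewer inner poles, apart from `0`, and fewer outer poles. -/
lemma IsAWContour.of_params (hC : IsAWContour a b c d q C) {a' b' c' d' : ℂ}
    (h : ∀ e' ∈ ({a', b', c', d'} : Set ℂ),
      e' = 0 ∨ ∃ k : ℕ, ∃ e ∈ ({a, b, c, d} : Set ℂ), e' = e * q ^ k) :
    IsAWContour a' b' c' d' q C := by
  have hin : ∀ w ∈ innerPoles a' b' c' d' q, w = 0 ∨ w ∈ innerPoles a b c d q := by
    rintro w ⟨k, e', he', rfl⟩
    rcases h e' he' with rfl | ⟨m, e, he, rfl⟩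
    · exact .inl (zero_mul _)
    · exact .inr ⟨m + k, e, he, by ring⟩
  have hout : ∀ w ∈ outerPoles a' b' c' d' q, w ∈ outerPoles a b c d q := by
    rintro w ⟨k, e', he', hw⟩
    rcases h e' he' with rfl | ⟨m, e, he, rfl⟩
    · simp at hw
    · exact ⟨m + k, e, he, by rw [← hw]; ring⟩
  refine ⟨hC.path, fun t ht => ?_, hC.encloses_zero, fun w hw => ?_,
    fun w hw => hC.excludes w (hout w hw)⟩
  · obtain ⟨h0, h1, h2⟩ := hC.avoids t ht
    exact ⟨h0, fun hw => (hin _ hw).elim h0 h1, fun hw => h2 (hout _ hw)⟩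
  · rcases hin w hw with rfl | hw
    · exact hC.encloses_zero
    · exact hC.encloses w hw

lemma IsAWContour.shift (hC : IsAWContour a b c d q C) (k : ℕ) :
    IsAWContour (a * q ^ k) b c d q C := by
  refine hC.of_params fun e' he' => .inr ?_
  rcases he' with rfl | he'
  · exact ⟨k, a, by simp, rfl⟩
  · exact ⟨0, e', Set.mem_insert_of_mem _ he', by simp⟩

lemma IsAWContour.zero_left (hC : IsAWContour a b c d q C) : IsAWContour 0 b c d q C := by
  refine hC.of_params fun e' he' => ?_
  rcases he' with rfl | he'
  · exact .inl rfl
  · exact .inr ⟨0, e', Set.mem_insert_of_mem _ he', by simp⟩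

lemma IsAWContour.perm (hC : IsAWContour a b c d q C) {a' b' c' d' : ℂ}
    (h : ∀ e' ∈ ({a', b', c', d'} : Set ℂ), e' ∈ ({a, b, c, d} : Set ℂ)) :
    IsAWContour a' b' c' d' q C :=
  hC.of_params fun e' he' => .inr ⟨0, e', h e' he', by simp⟩

lemma IsAWContour.ne_zero (hC : IsAWContour a b c d q C) {z : ℂ} (hz : z ∈ C '' Set.Icc 0 1) :
    z ≠ 0 := by
  obtain ⟨t, ht, rfl⟩ := hz
  exact (hC.avoids t ht).1

lemma IsAWContour.mul_ne_one (hC : IsAWContour a b c d q C) {z : ℂ} (hz : z ∈ C '' Set.Icc 0 1)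
    {e : ℂ} (he : e ∈ ({a, b, c, d} : Set ℂ)) (k : ℕ) : e * z * q ^ k ≠ 1 := by
  obtain ⟨t, ht, rfl⟩ := hz
  exact fun h => (hC.avoids t ht).2.2 ⟨k, e, he, by rw [← h]; ring⟩

lemma IsAWContour.mul_inv_ne_one (hC : IsAWContour a b c d q C) {z : ℂ}
    (hz : z ∈ C '' Set.Icc 0 1) {e : ℂ} (he : e ∈ ({a, b, c, d} : Set ℂ)) (k : ℕ) :
    e * z⁻¹ * q ^ k ≠ 1 := by
  have h0 := hC.ne_zero hz
  obtain ⟨t, ht, rfl⟩ := hz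
  refine fun h => (hC.avoids t ht).2.1 ⟨k, e, he, ?_⟩
  field_simp at h
  exact h.symm

/-- An inner pole is never an outer pole, because their winding numbers differ. -/
lemma IsAWContour.param_mul_ne_one (hC : IsAWContour a b c d q C) {e f : ℂ}
    (he : e ∈ ({a, b, c, d} : Set ℂ)) (hf : f ∈ ({a, b, c, d} : Set ℂ)) (k : ℕ) :
    e * f * q ^ k ≠ 1 := by
  intro h
  have h1 := hC.encloses e ⟨0, e, he, by simp⟩
  have h2 := hC.excludes e ⟨k, f, hf, by rw [← h]; ring⟩
  exact one_ne_zero (h1.symm.trans h2)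

end Params

/-! ### The functional equation of the Askey-Wilson integral -/

section Kernel

open Filter Topology

/-- The Askey-Wilson weight without its normalizing constant `h₀`. -/
noncomputable def awKernel (a b c d q z : ℂ) : ℂ :=
  (qPochInf q (z ^ 2) * qPochInf q (z⁻¹ ^ 2)) /
    (qPochInf q (a * z) * qPochInf q (a * z⁻¹) * qPochInf q (b * z) * qPochInf q (b * z⁻¹) *
      qPochInf q (c * z) * qPochInf q (c * z⁻¹) * qPochInf q (d * z) * qPochInf q (d * z⁻¹))

/-- The integral of the unnormalized weight against `dz / z`. -/
noncomputable def awTotal (a b c d q : ℂ) (C : ℝ → ℂ) : ℂ :=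
  contourIntegral C fun z => awKernel a b c d q z * z⁻¹

/-- The function whose difference `q G(qz) - G(z)` yields the functional equation, as an expression
in `Q x = (x;q)_∞`; replacing `Q x` by `(x;q)_n` gives rational approximations. -/
noncomputable def awPotential (Q : ℂ → ℂ) (a b c d q z : ℂ) : ℂ :=
  z⁻¹ ^ 2 * (Q (q⁻¹ * z ^ 2) * Q (q ^ 2 * z⁻¹ ^ 2)) *
    (((Q (a * z))⁻¹ * (Q (a * q * z⁻¹))⁻¹) * ((Q (b * z))⁻¹ * (Q (b * q * z⁻¹))⁻¹) *
      ((Q (c * z))⁻¹ * (Q (c * q * z⁻¹))⁻¹) * ((Q (d * z))⁻¹ * (Q (d * q * z⁻¹))⁻¹))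

/-- A set containing the poles of `awPotential`. -/
def potentialPoles (a b c d q : ℂ) : Set ℂ :=
  {0} ∪ innerPoles (a * q) (b * q) (c * q) (d * q) q ∪ outerPoles a b c d q

variable {a b c d q : ℂ} {C : ℝ → ℂ}

lemma awWeight_eq (a b c d q z : ℂ) :
    awWeight a b c d q z = (awH0 a b c d q)⁻¹ * awKernel a b c d q z := by
  rw [awWeight, awKernel, mul_comm (awH0 a b c d q), ← div_div, div_eq_inv_mul _ (awH0 a b c d q)]

/-- The approximations by finite products are rational functions with the poles of the potential. -/
lemma isRationalOff_awPotential (a b c d q : ℂ) (n : ℕ) :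
    IsRationalOff (potentialPoles a b c d q)
      (awPotential (fun x => qPoch q x n) a b c d q) := by
  have h0 : (0 : ℂ) ∈ potentialPoles a b c d q := .inl (.inl rfl)
  have key : ∀ e ∈ ({a, b, c, d} : Set ℂ), IsRationalOff (potentialPoles a b c d q)
      fun z => (qPoch q (e * z) n)⁻¹ * (qPoch q (e * q * z⁻¹) n)⁻¹ := fun e he => by
    refine (IsRationalOff.inv_qPoch_mul (fun k w hw => .inr ⟨k, e, he, hw⟩) n).mul
      (IsRationalOff.inv_qPoch_mul_inv h0 (fun k => .inl (.inr ⟨k, e * q, ?_, rfl⟩)) n)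
    rcases he with rfl | rfl | rfl | rfl <;> simp
  have hinv : IsRationalOff (potentialPoles a b c d q) fun z => z⁻¹ ^ 2 := by
    simpa only [sq] using (IsRationalOff.inv h0).mul (.inv h0)
  exact (hinv.mul ((((IsRationalOff.const _ _).mul (.pow 2)).qPoch q n).mul
    (((IsRationalOff.const _ _).mul hinv).qPoch q n))).mul
      ((((key a (by simp)).mul (key b (by simp))).mul (key c (by simp))).mul (key d (by simp)))

lemma boundedlyTendsto_awPotential (hq1 : ‖q‖ < 1) {K : Set ℂ} (hK : IsCompact K)
    (hP : ∀ z ∈ K, z ∉ potentialPoles a b c d q) :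
    BoundedlyTendsto K (fun n => awPotential (fun x => qPoch q x n) a b c d q)
      (awPotential (qPochInf q) a b c d q) := by
  have hz0 : ∀ z ∈ K, z ≠ 0 := fun z hz h => hP z hz (.inl (.inl h))
  have hinv : ContinuousOn (fun z : ℂ => z⁻¹) K := continuousOn_inv₀.mono hz0
  have key : ∀ e ∈ ({a, b, c, d} : Set ℂ), BoundedlyTendsto K
      (fun n z => (qPoch q (e * z) n)⁻¹ * (qPoch q (e * q * z⁻¹) n)⁻¹)
      (fun z => (qPochInf q (e * z))⁻¹ * (qPochInf q (e * q * z⁻¹))⁻¹) := fun e he => by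
    refine (BoundedlyTendsto.inv_qPoch hq1 hK (by fun_prop) fun z hz k hk => ?_).mul
      (.inv_qPoch hq1 hK (by fun_prop) fun z hz k hk => ?_)
    · exact hP z hz (.inr ⟨k, e, he, by rw [← hk]; ring⟩)
    · have h0 := hz0 z hz
      refine hP z hz (.inl (.inr ⟨k, e * q, ?_, ?_⟩))
      · rcases he with rfl | rfl | rfl | rfl <;> simp
      · field_simp at hk
        exact hk.symm
  exact ((BoundedlyTendsto.const hK (by fun_prop)).mul
    ((BoundedlyTendsto.qPoch hq1 hK (by fun_prop)).mul (.qPoch hq1 hK (by fun_prop)))).mul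
      ((((key a (by simp)).mul (key b (by simp))).mul (key c (by simp))).mul (key d (by simp)))

lemma mem_params_mul_iff {e' : ℂ} :
    e' ∈ ({a * q, b * q, c * q, d * q} : Set ℂ) ↔ ∃ e ∈ ({a, b, c, d} : Set ℂ), e' = e * q := by
  simp

lemma IsAWContour.not_mem_potentialPoles (hC : IsAWContour a b c d q C) :
    ∀ z ∈ C '' Set.Icc 0 1, z ∉ potentialPoles a b c d q := by
  rintro z hz ((h | ⟨k, e', he', h⟩) | ⟨k, e, he, h⟩)
  · exact hC.ne_zero hz h
  · obtain ⟨e, he, rfl⟩ := mem_params_mul_iff.1 he'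
    obtain ⟨t, ht, rfl⟩ := hz
    exact (hC.avoids t ht).2.1 ⟨k + 1, e, he, by rw [h]; ring⟩
  · exact hC.mul_ne_one hz he k (by rw [← h]; ring)

/-- The contours `C` and `q C` wind equally often around every pole of the potential, so the two
integrals agree even if poles are crossed when `C` is scaled to `q C`. -/
lemma contourIntegral_awPotential (hq0 : q ≠ 0) (hq1 : ‖q‖ < 1) (hC : IsAWContour a b c d q C) :
    contourIntegral (fun t => q * C t) (awPotential (qPochInf q) a b c d q) =
      contourIntegral C (awPotential (qPochInf q) a b c d q) := by
  have hqC := hC.path.const_mul q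
  have ha₁ := hC.not_mem_potentialPoles
  have ha₂ : ∀ z ∈ (fun t => q * C t) '' Set.Icc 0 1, z ∉ potentialPoles a b c d q := by
    rintro _ ⟨t, ht, rfl⟩ ((h | ⟨k, e', he', h⟩) | ⟨k, e, he, h⟩)
    · exact mul_ne_zero hq0 (hC.avoids t ht).1 h
    · obtain ⟨e, he, rfl⟩ := mem_params_mul_iff.1 he'
      refine (hC.avoids t ht).2.1 ⟨k, e, he, mul_left_cancel₀ hq0 (h.trans ?_)⟩
      ring
    · exact (hC.avoids t ht).2.2 ⟨k + 1, e, he, by rw [← h]; ring⟩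
  have hw : ∀ s ∈ potentialPoles a b c d q,
      windingNum (fun t => q * C t) s = windingNum C s := by
    rintro s ((rfl | ⟨k, e', he', rfl⟩) | ⟨k, e, he, h⟩)
    · simpa using windingNum_const_mul (γ := C) hq0 0
    · obtain ⟨e, he, rfl⟩ := mem_params_mul_iff.1 he'
      rw [show e * q * q ^ k = q * (e * q ^ k) by ring, windingNum_const_mul hq0,
        hC.encloses _ ⟨k, e, he, rfl⟩, hC.encloses _ ⟨k + 1, e, he, by ring⟩]
    · rw [hC.excludes s ⟨k, e, he, h⟩, ← mul_div_cancel₀ s hq0,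
        windingNum_const_mul hq0]
      refine hC.excludes _ ⟨k + 1, e, he, ?_⟩
      rw [← h]
      field_simp
      ring
  exact tendsto_nhds_unique
    (hqC.tendsto_contourIntegral (boundedlyTendsto_awPotential hq1 hqC.isCompact_image ha₂))
    ((hC.path.tendsto_contourIntegral
      (boundedlyTendsto_awPotential hq1 hC.path.isCompact_image ha₁)).congr fun n =>
        ((isRationalOff_awPotential a b c d q n).contourIntegral_eq hqC hC.path ha₂ ha₁ hw).symm)

/-- The functional equation of the potential. The elementary factors of the two terms combine
into `(1 - z²)(1 - z⁻²) / z` times a linear polynomial in `z + 1 / z`. -/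
lemma awPotential_sub (hq0 : q ≠ 0) (hq1 : ‖q‖ < 1) {z : ℂ} (hz : z ≠ 0)
    (h1 : ∀ e ∈ ({a, b, c, d} : Set ℂ), 1 - e * z ≠ 0)
    (h2 : ∀ e ∈ ({a, b, c, d} : Set ℂ), 1 - e * z⁻¹ ≠ 0) :
    q * awPotential (qPochInf q) a b c d q (q * z) - awPotential (qPochInf q) a b c d q z =
      q⁻¹ * (awKernel a b c d q z * z⁻¹ * ((1 - a * b * c * d) * (z + z⁻¹) -
        (a + b + c + d - (a * b * c + a * b * d + a * c * d + b * c * d)))) := by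
  -- everything is a rational multiple of `(qz², q/z²;q)_∞ / ∏ (ez, e/z;q)_∞`
  have num1 : qPochInf q (q⁻¹ * z ^ 2) * qPochInf q (q ^ 2 * z⁻¹ ^ 2) =
      -(z ^ 2 * q⁻¹) * (1 - z ^ 2) * (qPochInf q (q * z ^ 2) * qPochInf q (q * z⁻¹ ^ 2)) := by
    rw [qPochInf_eq_one_sub_mul hq1 (q⁻¹ * z ^ 2), qPochInf_eq_one_sub_mul hq1 (q⁻¹ * z ^ 2 * q),
      qPochInf_eq_one_sub_mul hq1 (q * z⁻¹ ^ 2), show q⁻¹ * z ^ 2 * q = z ^ 2 by field_simp,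
      show z ^ 2 * q = q * z ^ 2 by ring, show q * z⁻¹ ^ 2 * q = q ^ 2 * z⁻¹ ^ 2 by ring]
    field_simp
    ring
  have num2 : qPochInf q (q⁻¹ * (q * z) ^ 2) * qPochInf q (q ^ 2 * (q * z)⁻¹ ^ 2) =
      (1 - z⁻¹ ^ 2) * (qPochInf q (q * z ^ 2) * qPochInf q (q * z⁻¹ ^ 2)) := by
    rw [show q⁻¹ * (q * z) ^ 2 = q * z ^ 2 by field_simp,
      show q ^ 2 * (q * z)⁻¹ ^ 2 = z⁻¹ ^ 2 by field_simp,
      qPochInf_eq_one_sub_mul hq1 (z⁻¹ ^ 2), show z⁻¹ ^ 2 * q = q * z⁻¹ ^ 2 by ring]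
    ring
  have num3 : qPochInf q (z ^ 2) * qPochInf q (z⁻¹ ^ 2) = (1 - z ^ 2) * (1 - z⁻¹ ^ 2) *
      (qPochInf q (q * z ^ 2) * qPochInf q (q * z⁻¹ ^ 2)) := by
    rw [qPochInf_eq_one_sub_mul hq1 (z ^ 2), qPochInf_eq_one_sub_mul hq1 (z⁻¹ ^ 2),
      show z ^ 2 * q = q * z ^ 2 by ring, show z⁻¹ ^ 2 * q = q * z⁻¹ ^ 2 by ring]
    ring
  have den1 : ∀ e ∈ ({a, b, c, d} : Set ℂ), (qPochInf q (e * z))⁻¹ * (qPochInf q (e * q * z⁻¹))⁻¹ =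
      (1 - e * z⁻¹) * ((qPochInf q (e * z))⁻¹ * (qPochInf q (e * z⁻¹))⁻¹) := fun e he => by
    rw [qPochInf_eq_one_sub_mul hq1 (e * z⁻¹), show e * z⁻¹ * q = e * q * z⁻¹ by ring, mul_inv,
      mul_left_comm, mul_inv_cancel_left₀ (h2 e he)]
  have den2 : ∀ e ∈ ({a, b, c, d} : Set ℂ),
      (qPochInf q (e * (q * z)))⁻¹ * (qPochInf q (e * q * (q * z)⁻¹))⁻¹ =
      (1 - e * z) * ((qPochInf q (e * z))⁻¹ * (qPochInf q (e * z⁻¹))⁻¹) := fun e he => by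
    rw [qPochInf_eq_one_sub_mul hq1 (e * z), show e * q * (q * z)⁻¹ = e * z⁻¹ by field_simp,
      show e * z * q = e * (q * z) by ring, mul_inv, mul_assoc, mul_inv_cancel_left₀ (h1 e he)]
  rw [awPotential, awPotential, awKernel, num1, num2, num3, den1 a (by simp), den1 b (by simp),
    den1 c (by simp), den1 d (by simp), den2 a (by simp), den2 b (by simp), den2 c (by simp),
    den2 d (by simp)]
  simp only [div_eq_mul_inv, mul_inv]
  generalize qPochInf q (q * z ^ 2) * qPochInf q (q * z⁻¹ ^ 2) = N
  generalize (qPochInf q (a * z))⁻¹ = A1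
  generalize (qPochInf q (a * z⁻¹))⁻¹ = A2
  generalize (qPochInf q (b * z))⁻¹ = B1
  generalize (qPochInf q (b * z⁻¹))⁻¹ = B2
  generalize (qPochInf q (c * z))⁻¹ = C1
  generalize (qPochInf q (c * z⁻¹))⁻¹ = C2
  generalize (qPochInf q (d * z))⁻¹ = D1
  generalize (qPochInf q (d * z⁻¹))⁻¹ = D2
  field_simp
  ring

lemma IsAWContour.qPochInf_mul_ne_zero (hq1 : ‖q‖ < 1) (hC : IsAWContour a b c d q C) {z : ℂ}
    (hz : z ∈ C '' Set.Icc 0 1) {e : ℂ} (he : e ∈ ({a, b, c, d} : Set ℂ)) :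
    qPochInf q (e * z) ≠ 0 ∧ qPochInf q (e * z⁻¹) ≠ 0 :=
  ⟨qPochInf_ne_zero hq1 (hC.mul_ne_one hz he), qPochInf_ne_zero hq1 (hC.mul_inv_ne_one hz he)⟩

lemma IsAWContour.continuousOn_inv (hC : IsAWContour a b c d q C) :
    ContinuousOn (fun z : ℂ => z⁻¹) (C '' Set.Icc 0 1) :=
  continuousOn_inv₀.mono fun _ hz => hC.ne_zero hz

lemma IsAWContour.continuousOn_awKernel (hq1 : ‖q‖ < 1) (hC : IsAWContour a b c d q C) :
    ContinuousOn (awKernel a b c d q) (C '' Set.Icc 0 1) := by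
  have hQ := continuous_qPochInf hq1
  have hinv := hC.continuousOn_inv
  refine ContinuousOn.div (by fun_prop) (by fun_prop) fun z hz => ?_
  have h := fun e he => hC.qPochInf_mul_ne_zero hq1 hz (e := e) he
  have ha := h a (by simp)
  have hb := h b (by simp)
  have hc := h c (by simp)
  have hd := h d (by simp)
  simp only [ne_eq, mul_eq_zero, not_or]
  exact ⟨⟨⟨⟨⟨⟨⟨ha.1, ha.2⟩, hb.1⟩, hb.2⟩, hc.1⟩, hc.2⟩, hd.1⟩, hd.2⟩

/-- The moment of a polynomial of degree one in `z + 1 / z` vanishes; in terms of `G = awPotential`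
its integrand is a multiple of `q G(qz) - G(z)`. -/
lemma contourIntegral_awKernel_mul_linear (hq0 : q ≠ 0) (hq1 : ‖q‖ < 1)
    (hC : IsAWContour a b c d q C) :
    contourIntegral C (fun z => awKernel a b c d q z * z⁻¹ * ((1 - a * b * c * d) * (z + z⁻¹) -
      (a + b + c + d - (a * b * c + a * b * d + a * c * d + b * c * d)))) = 0 := by
  set H : ℂ → ℂ := fun z => awKernel a b c d q z * z⁻¹ * ((1 - a * b * c * d) * (z + z⁻¹) -
      (a + b + c + d - (a * b * c + a * b * d + a * c * d + b * c * d))) with hH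
  have hinv := hC.continuousOn_inv
  have hK := hC.continuousOn_awKernel hq1
  have hHc : ContinuousOn (fun z => q⁻¹ * H z) (C '' Set.Icc 0 1) := by
    simp only [hH]
    fun_prop
  have hP : ∀ z ∈ C '' Set.Icc 0 1, z ∉ potentialPoles a b c d q :=
    hC.not_mem_potentialPoles
  have hG := (boundedlyTendsto_awPotential hq1 hC.path.isCompact_image hP).continuousOn_lim
  have h1 := contourIntegral_awPotential hq0 hq1 hC
  rw [contourIntegral_comp_const_mul, ← contourIntegral_const_mul,
    contourIntegral_congr (g := fun z => q⁻¹ * H z + awPotential (qPochInf q) a b c d q z),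
    contourIntegral_add (hC.path.contourIntegrable hHc) (hC.path.contourIntegrable hG),
    contourIntegral_const_mul] at h1
  · simpa [hq0] using h1
  · intro t ht
    have hz : C t ∈ C '' Set.Icc 0 1 := ⟨t, ht, rfl⟩
    rw [hH, ← awPotential_sub hq0 hq1 (hC.ne_zero hz), sub_add_cancel]
    · exact fun e he => sub_ne_zero.2 fun h => hC.mul_ne_one hz he 0 (by simpa using h.symm)
    · exact fun e he => sub_ne_zero.2 fun h => hC.mul_inv_ne_one hz he 0 (by simpa using h.symm)

lemma awKernel_shift (hq1 : ‖q‖ < 1) (hC : IsAWContour a b c d q C) {z : ℂ}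
    (hz : z ∈ C '' Set.Icc 0 1) (k : ℕ) :
    awKernel (a * q ^ k) b c d q z =
      qPoch q (a * z) k * qPoch q (a * z⁻¹) k * awKernel a b c d q z := by
  have h1 := qPoch_ne_zero (hC.mul_ne_one hz (e := a) (by simp)) k
  have h2 := qPoch_ne_zero (hC.mul_inv_ne_one hz (e := a) (by simp)) k
  rw [awKernel, awKernel, qPochInf_eq_mul hq1 (a * z) k, qPochInf_eq_mul hq1 (a * z⁻¹) k,
    show a * z * q ^ k = a * q ^ k * z by ring, show a * z⁻¹ * q ^ k = a * q ^ k * z⁻¹ by ring]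
  generalize qPoch q (a * z) k = A at *
  generalize qPoch q (a * z⁻¹) k = B at *
  field_simp

lemma awKernel_zero_left (hq1 : ‖q‖ < 1) (hC : IsAWContour a b c d q C) {z : ℂ}
    (hz : z ∈ C '' Set.Icc 0 1) :
    awKernel 0 b c d q z =
      qPochInf q (a * z) * qPochInf q (a * z⁻¹) * awKernel a b c d q z := by
  have h := hC.qPochInf_mul_ne_zero hq1 hz (e := a) (by simp)
  have h1 := h.1
  have h2 := h.2
  simp only [awKernel, zero_mul, qPochInf_zero, one_mul]
  generalize qPochInf q (a * z) = A at *
  generalize qPochInf q (a * z⁻¹) = B at *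
  field_simp

/-- The linear relation expresses `(1 - az)(1 - a/z)`, whose product with the weight is the weight
for `a q`, through constants. -/
lemma awTotal_shift_one (hq0 : q ≠ 0) (hq1 : ‖q‖ < 1) (hC : IsAWContour a b c d q C) :
    (1 - a * b * c * d) * awTotal (a * q) b c d q C =
      (1 - a * b) * (1 - a * c) * (1 - a * d) * awTotal a b c d q C := by
  have hinv := hC.continuousOn_inv
  have hK := hC.continuousOn_awKernel hq1
  have h0 := contourIntegral_awKernel_mul_linear hq0 hq1 hC
  rw [awTotal, awTotal, ← contourIntegral_const_mul, contourIntegral_congr (g := fun z =>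
    (1 - a * b) * (1 - a * c) * (1 - a * d) * (awKernel a b c d q z * z⁻¹) +
      (-a) * (awKernel a b c d q z * z⁻¹ * ((1 - a * b * c * d) * (z + z⁻¹) -
        (a + b + c + d - (a * b * c + a * b * d + a * c * d + b * c * d))))),
    contourIntegral_add (hC.path.contourIntegrable (by fun_prop))
      (hC.path.contourIntegrable (by fun_prop)), contourIntegral_const_mul,
    contourIntegral_const_mul (-a), h0, mul_zero, add_zero]
  intro t ht
  have hz : C t ∈ C '' Set.Icc 0 1 := ⟨t, ht, rfl⟩
  have h1 := hC.ne_zero hz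
  have h2 := awKernel_shift hq1 hC hz 1
  simp only [pow_one, qPoch, Finset.prod_range_one, pow_zero, mul_one] at h2
  simp only [h2]
  field_simp
  ring

lemma awTotal_shift (hq0 : q ≠ 0) (hq1 : ‖q‖ < 1) (hC : IsAWContour a b c d q C) (n : ℕ) :
    qPoch q (a * b * c * d) n * awTotal (a * q ^ n) b c d q C =
      qPoch q (a * b) n * qPoch q (a * c) n * qPoch q (a * d) n * awTotal a b c d q C := by
  induction n with
  | zero => simp
  | succ n ih =>
    have h := awTotal_shift_one hq0 hq1 (hC.shift n)
    simp only [qPoch_succ, pow_succ, ← mul_assoc]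
    linear_combination qPoch q (a * b * c * d) n * h +
      (1 - a * b * q ^ n) * (1 - a * c * q ^ n) * (1 - a * d * q ^ n) * ih

lemma tendsto_awTotal_shift (hq1 : ‖q‖ < 1) (hC : IsAWContour a b c d q C) :
    Tendsto (fun n => awTotal (a * q ^ n) b c d q C) atTop (𝓝 (awTotal 0 b c d q C)) := by
  have hinv := hC.continuousOn_inv
  have hK := hC.continuousOn_awKernel hq1
  have hc := hC.path.isCompact_image
  have h := hC.path.tendsto_contourIntegral
    ((((BoundedlyTendsto.qPoch hq1 hc (g := fun z => a * z) (by fun_prop)).mul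
      (.qPoch hq1 hc (g := fun z => a * z⁻¹) (by fun_prop))).mul (.const hc hK)).mul
        (.const hc hinv))
  rw [awTotal, contourIntegral_congr (g := fun z =>
    qPochInf q (a * z) * qPochInf q (a * z⁻¹) * awKernel a b c d q z * z⁻¹) fun t ht => by
      rw [awKernel_zero_left hq1 hC (Set.mem_image_of_mem C ht)]]
  exact h.congr fun n => contourIntegral_congr fun t ht => by
    simp only [awKernel_shift hq1 hC (Set.mem_image_of_mem C ht)]

lemma awTotal_mul_eq_awTotal_zero_left (hq0 : q ≠ 0) (hq1 : ‖q‖ < 1) (hC : IsAWContour a b c d q C) :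
    qPochInf q (a * b) * qPochInf q (a * c) * qPochInf q (a * d) * awTotal a b c d q C =
      qPochInf q (a * b * c * d) * awTotal 0 b c d q C :=
  tendsto_nhds_unique
    ((((tendsto_qPoch hq1 _).mul (tendsto_qPoch hq1 _)).mul (tendsto_qPoch hq1 _)).mul_const _)
    (((tendsto_qPoch hq1 _).mul (tendsto_awTotal_shift hq1 hC)).congr
      fun n => awTotal_shift hq0 hq1 hC n)

lemma awTotal_rotate (a b c d q : ℂ) (C : ℝ → ℂ) :
    awTotal a b c d q C = awTotal d a b c q C := by
  unfold awTotal awKernel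
  congr 1 with z
  congr 2
  ring

/-- Sending the four parameters to zero one after the other. -/
lemma awTotal_mul_eq_awTotal_zero (hq0 : q ≠ 0) (hq1 : ‖q‖ < 1) (hC : IsAWContour a b c d q C) :
    qPochInf q (a * b) * qPochInf q (a * c) * qPochInf q (a * d) * qPochInf q (b * c) *
      qPochInf q (b * d) * qPochInf q (c * d) * awTotal a b c d q C =
      qPochInf q (a * b * c * d) * awTotal 0 0 0 0 q C := by
  have hd : IsAWContour d 0 b c q C := hC.zero_left.perm fun e he => by
    simp only [Set.mem_insert_iff, Set.mem_singleton_iff] at he ⊢; tauto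
  have hc : IsAWContour c 0 0 b q C := hd.zero_left.perm fun e he => by
    simp only [Set.mem_insert_iff, Set.mem_singleton_iff] at he ⊢; tauto
  have hb : IsAWContour b 0 0 0 q C := hc.zero_left.perm fun e he => by
    simp only [Set.mem_insert_iff, Set.mem_singleton_iff] at he ⊢; tauto
  have h1 := awTotal_mul_eq_awTotal_zero_left hq0 hq1 hC
  have h2 := awTotal_mul_eq_awTotal_zero_left hq0 hq1 hd
  have h3 := awTotal_mul_eq_awTotal_zero_left hq0 hq1 hc
  have h4 := awTotal_mul_eq_awTotal_zero_left hq0 hq1 hb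
  simp only [mul_zero, zero_mul, qPochInf_zero, one_mul, mul_one] at h2 h3 h4
  rw [awTotal_rotate 0 b c d] at h1
  rw [awTotal_rotate 0 0 b c] at h2
  rw [awTotal_rotate 0 0 0 b, h4] at h3
  rw [← h3] at h4 ⊢
  rw [mul_comm d b, mul_comm d c] at h2
  rw [mul_comm c b]
  linear_combination qPochInf q (b * c) * qPochInf q (b * d) * qPochInf q (c * d) * h1 +
    qPochInf q (b * c) * qPochInf q (a * b * c * d) * h2

end Kernel

/-! ### The total mass for vanishing parameters -/

section UnitCircle

open Filter Topology

/-- The positively oriented unit circle, parametrized by `[0, 1]`. -/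
noncomputable def unitCircle (t : ℝ) : ℂ := circleMap 0 1 (2 * Real.pi * t)

lemma hasDerivAt_unitCircle (t : ℝ) :
    HasDerivAt unitCircle (2 * Real.pi * deriv (circleMap 0 1) (2 * Real.pi * t)) t := by
  have h := (differentiable_circleMap 0 1 (2 * Real.pi * t)).hasDerivAt.scomp t
    ((hasDerivAt_id t).const_mul (2 * Real.pi))
  refine h.congr_deriv ?_
  simp

lemma deriv_unitCircle :
    deriv unitCircle = fun t => 2 * Real.pi * deriv (circleMap 0 1) (2 * Real.pi * t) :=
  funext fun t => (hasDerivAt_unitCircle t).deriv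

lemma norm_unitCircle (t : ℝ) : ‖unitCircle t‖ = 1 := by simp [unitCircle]

lemma isClosedPath_unitCircle : IsClosedPath unitCircle := by
  have hd : Continuous (deriv unitCircle) := by
    rw [deriv_unitCircle]
    simp only [deriv_circleMap]
    fun_prop
  exact ⟨(Differentiable.continuous fun t =>
    (hasDerivAt_unitCircle t).differentiableAt).continuousOn, by simp [unitCircle, circleMap],
    ⟨∅, Set.finite_empty, fun t _ => (hasDerivAt_unitCircle t).differentiableAt, hd.continuousOn⟩,
    hd.intervalIntegrable _ _⟩

lemma contourIntegral_unitCircle (f : ℂ → ℂ) :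
    contourIntegral unitCircle f = ∮ z in C(0, 1), f z := by
  have h := intervalIntegral.smul_integral_comp_mul_left (a := 0) (b := 1)
    (fun θ => deriv (circleMap 0 1) θ • f (circleMap 0 1 θ)) (2 * Real.pi)
  rw [mul_zero, mul_one] at h
  rw [circleIntegral, ← h, ← intervalIntegral.integral_smul, contourIntegral, deriv_unitCircle]
  refine intervalIntegral.integral_congr fun t _ => ?_
  simp only [unitCircle, smul_eq_mul, Complex.real_smul]
  push_cast
  ring

lemma windingNum_unitCircle_of_norm_lt {w : ℂ} (hw : ‖w‖ < 1) : windingNum unitCircle w = 1 := by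
  rw [windingNum, contourIntegral_unitCircle, circleIntegral.integral_sub_inv_of_mem_ball
    (by simpa using hw), inv_mul_cancel₀ Complex.two_pi_I_ne_zero]

lemma windingNum_unitCircle_of_lt_norm {w : ℂ} (hw : 1 < ‖w‖) : windingNum unitCircle w = 0 := by
  have hne : ∀ z ∈ Metric.closedBall (0 : ℂ) 1, z - w ≠ 0 := fun z hz => sub_ne_zero.2 fun h => by
    rw [mem_closedBall_zero_iff, h] at hz
    linarith
  have h : (∮ z in C(0, 1), (z - w)⁻¹) = 0 :=
    Complex.circleIntegral_eq_zero_of_differentiable_on_off_countable zero_le_one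
      Set.countable_empty (ContinuousOn.inv₀ (by fun_prop) hne) fun z hz =>
        DifferentiableAt.inv (by fun_prop) (hne z (Metric.ball_subset_closedBall hz.1))
  rw [windingNum, contourIntegral_unitCircle, h, mul_zero]

lemma isAWContour_unitCircle {a b c d q : ℂ} (hq : ‖q‖ < 1)
    (h : ∀ e ∈ ({a, b, c, d} : Set ℂ), ‖e‖ < 1) : IsAWContour a b c d q unitCircle := by
  have hlt : ∀ (k : ℕ), ∀ e ∈ ({a, b, c, d} : Set ℂ), ‖e * q ^ k‖ < 1 := fun k e he => by
    rw [norm_mul, norm_pow]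
    exact mul_lt_one_of_nonneg_of_lt_one_left (norm_nonneg _) (h e he)
      (pow_le_one₀ (norm_nonneg _) hq.le)
  have hin : ∀ w ∈ innerPoles a b c d q, ‖w‖ < 1 := by
    rintro w ⟨k, e, he, rfl⟩
    exact hlt k e he
  have hout : ∀ w ∈ outerPoles a b c d q, 1 < ‖w‖ := by
    rintro w ⟨k, e, he, hw⟩
    have h1 := hlt k e he
    have h2 : ‖w‖ * ‖e * q ^ k‖ = 1 := by rw [← norm_mul, hw, norm_one]
    by_contra! h3
    nlinarith [norm_nonneg w, norm_nonneg (e * q ^ k)]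
  refine ⟨isClosedPath_unitCircle, fun t _ => ⟨?_, fun hw => ?_, fun hw => ?_⟩,
    windingNum_unitCircle_of_norm_lt (by simp), fun w hw =>
      windingNum_unitCircle_of_norm_lt (hin w hw), fun w hw =>
      windingNum_unitCircle_of_lt_norm (hout w hw)⟩
  · exact norm_ne_zero_iff.1 (by rw [norm_unitCircle]; exact one_ne_zero)
  · exact (hin _ hw).ne (norm_unitCircle t)
  · exact (hout _ hw).ne' (norm_unitCircle t)

end UnitCircle

section Mass

open Filter Topology

variable {a b c d q : ℂ} {C : ℝ → ℂ}

/-- For vanishing parameters the only pole is `0`, so the contour may be replaced by any other. -/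
lemma awTotal_zero_eq (hq1 : ‖q‖ < 1) {C₁ C₂ : ℝ → ℂ} (h₁ : IsAWContour 0 0 0 0 q C₁)
    (h₂ : IsAWContour 0 0 0 0 q C₂) : awTotal 0 0 0 0 q C₁ = awTotal 0 0 0 0 q C₂ := by
  have hbt : ∀ C, IsAWContour 0 0 0 0 q C → BoundedlyTendsto (C '' Set.Icc 0 1)
      (fun n z => qPoch q (z ^ 2) n * qPoch q (z⁻¹ ^ 2) n * z⁻¹)
      (fun z => awKernel 0 0 0 0 q z * z⁻¹) := fun C hC => by
    have hinv := hC.continuousOn_inv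
    have hc := hC.path.isCompact_image
    simp only [awKernel, zero_mul, qPochInf_zero, mul_one, div_one]
    exact ((BoundedlyTendsto.qPoch hq1 hc (by fun_prop)).mul (.qPoch hq1 hc (by fun_prop))).mul
      (.const hc hinv)
  have hinv := IsRationalOff.inv (P := {0}) rfl
  refine tendsto_nhds_unique (h₁.path.tendsto_contourIntegral (hbt _ h₁))
    ((h₂.path.tendsto_contourIntegral (hbt _ h₂)).congr fun n => ?_)
  refine IsRationalOff.contourIntegral_eq (P := {0}) ?_ h₂.path h₁.path
    (fun z hz => h₂.ne_zero hz) (fun z hz => h₁.ne_zero hz) ?_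
  · exact (((IsRationalOff.pow 2).qPoch q n).mul
      ((((hinv.mul hinv).congr fun z _ => (sq z⁻¹).symm)).qPoch q n)).mul hinv
  · rintro s rfl
    rw [h₁.encloses_zero, h₂.encloses_zero]

/-- For the parameters `q, -q, s, -s` with `s² = q` the weight is `(1 - z²)(1 - z⁻²)`. -/
lemma awKernel_special (hq1 : ‖q‖ < 1) {s : ℂ} (hs : s ^ 2 = q) {z : ℂ} (hz : ‖z‖ = 1) :
    awKernel q (-q) s (-s) q z = (1 - z ^ 2) * (1 - z⁻¹ ^ 2) := by
  have key : ∀ y : ℂ, qPochInf q (q * y) * qPochInf q (-q * y) * qPochInf q (s * y) *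
      qPochInf q (-s * y) = qPochInf q (q * y ^ 2) := fun y => by
    rw [mul_assoc, neg_mul, neg_mul, qPochInf_mul_qPochInf_neg hq1, qPochInf_mul_qPochInf_neg hq1,
      ← qPochInf_sq_mul hq1 (q * y ^ 2), mul_comm]
    congr 2
    · rw [← hs]; ring
    · ring
  have hne : ∀ y : ℂ, ‖y‖ = 1 → qPochInf q (q * y ^ 2) ≠ 0 := fun y hy =>
    qPochInf_ne_zero_of_norm_lt hq1 (by rw [norm_mul, norm_pow, hy]; simpa using hq1)
  have h1 := hne z hz
  have h2 := hne z⁻¹ (by rw [norm_inv, hz, inv_one])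
  have hden : qPochInf q (q * z) * qPochInf q (q * z⁻¹) * qPochInf q (-q * z) *
      qPochInf q (-q * z⁻¹) * qPochInf q (s * z) * qPochInf q (s * z⁻¹) * qPochInf q (-s * z) *
      qPochInf q (-s * z⁻¹) = qPochInf q (q * z ^ 2) * qPochInf q (q * z⁻¹ ^ 2) := by
    rw [← key z, ← key z⁻¹]
    ring
  rw [awKernel, hden, qPochInf_eq_one_sub_mul hq1 (z ^ 2), qPochInf_eq_one_sub_mul hq1 (z⁻¹ ^ 2),
    mul_comm (z ^ 2) q, mul_comm (z⁻¹ ^ 2) q, div_eq_iff (mul_ne_zero h1 h2)]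
  ring

lemma awTotal_special (hq1 : ‖q‖ < 1) {s : ℂ} (hs : s ^ 2 = q)
    (hC : IsAWContour q (-q) s (-s) q unitCircle) :
    awTotal q (-q) s (-s) q unitCircle = 4 * (Real.pi : ℂ) * Complex.I := by
  have hinv := hC.continuousOn_inv
  have hc1 : ContinuousOn (fun z : ℂ => 2 * (z - 0)⁻¹) (unitCircle '' Set.Icc 0 1) := by
    simp only [sub_zero]; fun_prop
  have hc2 : ContinuousOn (fun z : ℂ => -z - z⁻¹ ^ 3) (unitCircle '' Set.Icc 0 1) := by fun_prop
  rw [awTotal, contourIntegral_congr (g := fun z => 2 * (z - 0)⁻¹ + (-z - z⁻¹ ^ 3)),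
    contourIntegral_add (hC.path.contourIntegrable hc1) (hC.path.contourIntegrable hc2),
    contourIntegral_const_mul, contourIntegral_inv_sub, hC.encloses_zero,
    hC.path.contourIntegral_eq_zero (F := fun z => -z ^ 2 / 2 + (z ^ 2)⁻¹ / 2) hc2]
  · ring
  · intro z hz
    have h0 := hC.ne_zero hz
    have := (((hasDerivAt_pow 2 z).neg.div_const 2)).add
      (((hasDerivAt_pow 2 z).inv (pow_ne_zero 2 h0)).div_const 2)
    refine this.congr_deriv ?_
    norm_num
    field_simp
    ring
  · intro t _
    have h0 : unitCircle t ≠ 0 := norm_ne_zero_iff.1 (by rw [norm_unitCircle]; exact one_ne_zero)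
    simp only [awKernel_special hq1 hs (norm_unitCircle t), sub_zero]
    field_simp
    ring

/-- The constant term of `(z², z⁻²;q)_∞` is `2 / (q;q)_∞`. -/
lemma qPochInf_mul_awTotal_zero (hq0 : q ≠ 0) (hq1 : ‖q‖ < 1) (hC : IsAWContour 0 0 0 0 q C) :
    qPochInf q q * awTotal 0 0 0 0 q C = 4 * (Real.pi : ℂ) * Complex.I := by
  obtain ⟨s, hs⟩ : ∃ s : ℂ, s ^ 2 = q := IsAlgClosed.exists_pow_nat_eq q two_pos
  have hs1 : ‖s‖ < 1 := by
    rw [← hs, norm_pow] at hq1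
    by_contra! h
    nlinarith
  have hU : IsAWContour q (-q) s (-s) q unitCircle := isAWContour_unitCircle hq1 <| by
    rintro e (rfl | rfl | rfl | rfl) <;> simpa
  have hU0 : IsAWContour 0 0 0 0 q unitCircle :=
    isAWContour_unitCircle hq1 (by simp)
  have h := awTotal_mul_eq_awTotal_zero hq0 hq1 hU
  rw [awTotal_special hq1 hs hU, ← awTotal_zero_eq hq1 hC hU0] at h
  have e1 : qPochInf q (q * s) * qPochInf q (q * -s) = qPochInf (q ^ 2) (q ^ 3) := by
    rw [mul_neg, qPochInf_mul_qPochInf_neg hq1]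
    congr 1
    rw [← hs]; ring
  have e2 : qPochInf q (-q * s) * qPochInf q (-q * -s) = qPochInf (q ^ 2) (q ^ 3) := by
    rw [← e1, mul_comm]
    congr 2 <;> ring
  have e3 : qPochInf q (s * -s) = (1 + q) * qPochInf q (q * -q) := by
    rw [show s * -s = -q by rw [← hs]; ring, qPochInf_eq_one_sub_mul hq1]
    ring_nf
  have e4 : qPochInf q q = (1 - q) * (1 - q ^ 2) * qPochInf q (q * -q * s * -s) := by
    rw [show q * -q * s * -s = q ^ 3 by rw [← hs]; ring, qPochInf_eq_one_sub_mul hq1 q,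
      qPochInf_eq_one_sub_mul hq1 (q * q)]
    ring_nf
  -- Euler's identity `(-q;q)_∞ (q;q²)_∞ = 1`
  have e5 : (1 - q) * (1 + q) * (qPochInf (q ^ 2) (q ^ 3) * qPochInf q (q * -q)) = 1 := by
    have h1 := qPochInf_sq_mul hq1 q
    have h2 := qPochInf_mul_qPochInf_neg hq1 q
    have h3 := qPochInf_eq_one_sub_mul hq1 (-q)
    have h4 := qPochInf_eq_one_sub_mul (norm_sq_lt_one hq1) q
    have h5 : qPochInf q q ≠ 0 := qPochInf_ne_zero_of_norm_lt hq1 hq1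
    rw [show -q * q = q * -q by ring] at h3
    rw [show q * q ^ 2 = q ^ 3 by ring] at h4
    rw [← sq, ← h2, h3, h4] at h1
    refine mul_left_cancel₀ h5 ?_
    linear_combination h1
  rw [e3] at h
  rw [e4]
  generalize qPochInf (q ^ 2) (q ^ 3) = E at *
  generalize qPochInf q (q * -q) = A at *
  have h' : A * E * E * ((1 + q) * A) * (4 * (Real.pi : ℂ) * Complex.I) =
      qPochInf q (q * -q * s * -s) * awTotal 0 0 0 0 q C := by
    rw [← h, ← e2]
    nth_rewrite 1 [e2]
    rw [← e1]
    ring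
  linear_combination -(1 - q) * (1 - q ^ 2) * h' +
    4 * (Real.pi : ℂ) * Complex.I * ((1 - q) * (1 + q) * (E * A) + 1) * e5

end Mass

/-! ### The Askey-Wilson integral and the moments of the interpolation basis -/

section Moments

variable {a b c d q : ℂ} {C : ℝ → ℂ}

lemma awH0_denom_ne_zero (hq1 : ‖q‖ < 1) (hC : IsAWContour a b c d q C) :
    qPochInf q q * qPochInf q (a * b) * qPochInf q (a * c) * qPochInf q (a * d) *
      qPochInf q (b * c) * qPochInf q (b * d) * qPochInf q (c * d) ≠ 0 := by
  have hne : ∀ e ∈ ({a, b, c, d} : Set ℂ), ∀ f ∈ ({a, b, c, d} : Set ℂ),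
      qPochInf q (e * f) ≠ 0 := fun e he f hf =>
    qPochInf_ne_zero hq1 (hC.param_mul_ne_one he hf)
  have hq : qPochInf q q ≠ 0 := qPochInf_ne_zero_of_norm_lt hq1 hq1
  have n1 := hne a (by simp) b (by simp)
  have n2 := hne a (by simp) c (by simp)
  have n3 := hne a (by simp) d (by simp)
  have n4 := hne b (by simp) c (by simp)
  have n5 := hne b (by simp) d (by simp)
  have n6 := hne c (by simp) d (by simp)
  simp [*]

/-- The Askey-Wilson integral evaluation, for the unnormalized weight. -/
lemma awTotal_eq (hq0 : q ≠ 0) (hq1 : ‖q‖ < 1) (hC : IsAWContour a b c d q C) :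
    awTotal a b c d q C = 4 * (Real.pi : ℂ) * Complex.I * awH0 a b c d q := by
  have h1 := awTotal_mul_eq_awTotal_zero hq0 hq1 hC
  have h2 := qPochInf_mul_awTotal_zero hq0 hq1 (hC.of_params (a' := 0) (b' := 0) (c' := 0)
    (d' := 0) fun e he => .inl (by simpa using he))
  rw [awH0, ← mul_div_assoc, eq_div_iff (awH0_denom_ne_zero hq1 hC)]
  linear_combination qPochInf q q * h1 + qPochInf q (a * b * c * d) * h2

lemma awH0_ne_zero (hq1 : ‖q‖ < 1) (habcd : ∀ m : ℕ, a * b * c * d * q ^ m ≠ 1)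
    (hC : IsAWContour a b c d q C) : awH0 a b c d q ≠ 0 :=
  div_ne_zero (qPochInf_ne_zero hq1 habcd) (awH0_denom_ne_zero hq1 hC)

lemma four_pi_I_ne_zero : 4 * (Real.pi : ℂ) * Complex.I ≠ 0 := by
  simp [Real.pi_ne_zero]

/-- Integrating `(az, a/z;q)_k` against the weight shifts the parameter `a` to `a q ^ k`. -/
lemma awIntegral_of_eq_qPoch (hq0 : q ≠ 0) (hq1 : ‖q‖ < 1)
    (habcd : ∀ m : ℕ, a * b * c * d * q ^ m ≠ 1) (hC : IsAWContour a b c d q C) (k : ℕ)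
    {f : ℂ → ℂ}
    (hf : ∀ z ≠ 0, f ((z + z⁻¹) / 2) = qPoch q (a * z) k * qPoch q (a * z⁻¹) k) :
    awIntegral a b c d q C f = qPoch q (a * b) k * qPoch q (a * c) k * qPoch q (a * d) k /
      qPoch q (a * b * c * d) k := by
  have hh := awH0_ne_zero hq1 habcd hC
  have hpi := four_pi_I_ne_zero
  have h1 := awTotal_shift hq0 hq1 hC k
  rw [awTotal_eq hq0 hq1 hC] at h1
  have h2 : awIntegral a b c d q C f =
      ((awH0 a b c d q)⁻¹ * (4 * (Real.pi : ℂ) * Complex.I)⁻¹) *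
        awTotal (a * q ^ k) b c d q C := by
    rw [awIntegral, awTotal, ← contourIntegral_const_mul]
    refine contourIntegral_congr fun t ht => ?_
    have hz : C t ∈ C '' Set.Icc 0 1 := ⟨t, ht, rfl⟩
    rw [hf _ (hC.ne_zero hz), awWeight_eq, awKernel_shift hq1 hC hz, div_eq_mul_inv, mul_inv]
    ring
  rw [h2, eq_div_iff (qPoch_ne_zero habcd k)]
  calc _ = (awH0 a b c d q)⁻¹ * (4 * (Real.pi : ℂ) * Complex.I)⁻¹ *
        (qPoch q (a * b * c * d) k * awTotal (a * q ^ k) b c d q C) := by ring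
    _ = _ := by rw [h1]; field_simp

lemma awIntegral_sum_mul (hq1 : ‖q‖ < 1) (hC : IsAWContour a b c d q C) {ι : Type*}
    (s : Finset ι) (r : ι → ℂ) (p : ι → ℂ[X]) :
    awIntegral a b c d q C (fun x => ∑ i ∈ s, r i * (p i).eval x) =
      ∑ i ∈ s, r i * awIntegral a b c d q C fun x => (p i).eval x := by
  have hK := hC.continuousOn_awKernel hq1
  have hinv := hC.continuousOn_inv
  simp only [awIntegral, ← contourIntegral_const_mul]
  rw [← contourIntegral_sum]
  · congr 1 with z
    rw [Finset.sum_mul, Finset.sum_div]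
    exact Finset.sum_congr rfl fun i _ => by ring
  · intro i _
    refine hC.path.contourIntegrable ?_
    have hp : ContinuousOn (fun z : ℂ => (p i).eval ((z + z⁻¹) / 2)) (C '' Set.Icc 0 1) :=
      (p i).continuous.comp_continuousOn (by fun_prop)
    have hden : ContinuousOn (fun z : ℂ => (4 * (Real.pi : ℂ) * Complex.I * z)⁻¹)
        (C '' Set.Icc 0 1) := ContinuousOn.inv₀ (by fun_prop)
      fun z hz => mul_ne_zero four_pi_I_ne_zero (hC.ne_zero hz)
    simp only [awWeight_eq, div_eq_mul_inv _ (4 * (Real.pi : ℂ) * Complex.I * _)]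
    fun_prop

end Moments

/-! ### Newton interpolation -/

section Newton

open Polynomial Finset

/-- Newton's interpolation formula, with the divided differences written as explicit sums. -/
lemma eq_sum_divided_difference_mul_nodal {F : Type*} [Field F] {v : ℕ → F}
    (hv : Function.Injective v) (n : ℕ) (p : F[X]) (hp : p.natDegree ≤ n) :
    p = ∑ k ∈ range (n + 1), C (∑ j ∈ range (k + 1),
      p.eval (v j) / ∏ i ∈ (range (k + 1)).erase j, (v j - v i)) * Lagrange.nodal (range k) v := by
  induction n generalizing p with
  | zero =>
    obtain ⟨r, rfl⟩ : ∃ r, p = C r := ⟨_, eq_C_of_natDegree_le_zero hp⟩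
    simp
  | succ n ih =>
    set r := ∑ j ∈ range (n + 1 + 1),
      p.eval (v j) / ∏ i ∈ (range (n + 1 + 1)).erase j, (v j - v i) with hr
    have hcoeff : p.coeff (n + 1) = r := by
      have := Lagrange.coeff_eq_sum (s := range (n + 1 + 1)) hv.injOn (P := p) (by
        rw [card_range]
        exact (degree_le_of_natDegree_le hp).trans_lt (by exact_mod_cast Nat.lt_succ_self _))
      rwa [card_range, Nat.add_sub_cancel] at this
    have hnodal : (Lagrange.nodal (range (n + 1)) v).natDegree = n + 1 := by
      rw [Lagrange.natDegree_nodal, card_range]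
    have hlead : (Lagrange.nodal (range (n + 1)) v).coeff (n + 1) = 1 := by
      have := (Lagrange.nodal_monic (s := range (n + 1)) (v := v)).coeff_natDegree
      rwa [hnodal] at this
    -- subtracting the last term lowers the degree and keeps the values at the other nodes
    have hdeg : (p - C r * Lagrange.nodal (range (n + 1)) v).natDegree ≤ n := by
      refine natDegree_le_iff_coeff_eq_zero.2 fun m hm => ?_
      rw [coeff_sub, coeff_C_mul]
      rcases (Nat.succ_le_of_lt hm).eq_or_lt with rfl | hm
      · rw [Nat.succ_eq_add_one, hcoeff, hlead, mul_one, sub_self]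
      · rw [coeff_eq_zero_of_natDegree_lt (hp.trans_lt hm),
          coeff_eq_zero_of_natDegree_lt (hnodal.trans_lt hm), mul_zero, sub_self]
    have h := ih _ hdeg
    rw [sum_range_succ, ← hr, ← sub_eq_iff_eq_add, h]
    refine sum_congr rfl fun k hk => ?_
    congr 2
    refine sum_congr rfl fun j hj => ?_
    have hj' : j ∈ range (n + 1) := by
      rw [mem_range] at *
      omega
    rw [eval_sub, eval_mul, Lagrange.eval_nodal_at_node hj', mul_zero, sub_zero]

end Newton

/-! ### The interpolation nodes -/

section Nodes

open Finset

/-- The node `x_j = (a q ^ j + a⁻¹ q ^ (-j)) / 2`, at which `(az, a/z;q)_k` vanishes for `j < k`. -/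
noncomputable def awNode (a q : ℂ) (j : ℕ) : ℂ := (q ^ j * a + q ^ (-(j : ℤ)) / a) / 2

variable {a q : ℂ}

lemma mul_sub_awNode (ha : a ≠ 0) (hq0 : q ≠ 0) {z : ℂ} (hz : z ≠ 0) (i : ℕ) :
    -2 * a * q ^ i * ((z + z⁻¹) / 2 - awNode a q i) =
      (1 - a * z * q ^ i) * (1 - a * z⁻¹ * q ^ i) := by
  rw [awNode, zpow_neg, zpow_natCast]
  field_simp
  ring

lemma mul_awNode_sub_awNode (ha : a ≠ 0) (hq0 : q ≠ 0) (i j : ℕ) :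
    -2 * a * q ^ i * (awNode a q j - awNode a q i) =
      (1 - a ^ 2 * q ^ (i + j)) * (1 - q ^ i / q ^ j) := by
  have h := mul_sub_awNode ha hq0 (mul_ne_zero (pow_ne_zero j hq0) ha) i
  rw [awNode, zpow_neg, zpow_natCast, show (q ^ j)⁻¹ / a = (q ^ j * a)⁻¹ by field_simp, h]
  field_simp
  ring

lemma injective_awNode (ha : a ≠ 0) (hq0 : q ≠ 0) (hq1 : ‖q‖ < 1)
    (h : ∀ k : ℕ, a * a * q ^ k ≠ 1) : Function.Injective (awNode a q) := by
  intro j i hji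
  have h1 := mul_awNode_sub_awNode ha hq0 i j
  rw [hji, sub_self, mul_zero, eq_comm, mul_eq_zero, or_iff_right, sub_eq_zero, eq_comm,
    div_eq_one_iff_eq (pow_ne_zero j hq0)] at h1
  · have h2 : ‖q‖ ^ i = ‖q‖ ^ j := by rw [← norm_pow, h1, norm_pow]
    exact ((pow_right_strictAnti₀ (norm_pos_iff.2 hq0) hq1).injective h2).symm
  · exact sub_ne_zero.2 fun h' => h (i + j) (by rw [← sq, ← h'])

lemma qPoch_mul_qPoch_eq_nodal (ha : a ≠ 0) (hq0 : q ≠ 0) (k : ℕ) {z : ℂ} (hz : z ≠ 0) :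
    (∏ i ∈ range k, (-2 * a * q ^ i)) *
      (Lagrange.nodal (range k) (awNode a q)).eval ((z + z⁻¹) / 2) =
      qPoch q (a * z) k * qPoch q (a * z⁻¹) k := by
  rw [Lagrange.eval_nodal, qPoch, qPoch, ← prod_mul_distrib, ← prod_mul_distrib]
  exact prod_congr rfl fun i _ => mul_sub_awNode ha hq0 hz i

lemma prod_range_erase {M : Type*} [CommMonoid M] (f : ℕ → M) (j m : ℕ) :
    ∏ i ∈ (range (j + m + 1)).erase j, f i =
      (∏ i ∈ range j, f i) * ∏ i ∈ range m, f (j + 1 + i) := by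
  have h : (range (j + m + 1)).erase j = range j ∪ Ico (j + 1) (j + m + 1) := by
    ext i
    simp only [mem_erase, mem_range, mem_union, mem_Ico]
    omega
  rw [h, prod_union, prod_Ico_eq_prod_range, show j + m + 1 - (j + 1) = m by omega]
  rw [disjoint_left]
  intro i hi hi'
  simp only [mem_range, mem_Ico] at hi hi'
  omega

/-- The factors with `i < j` of the denominators, rewritten through `1 - x = -x (1 - 1 / x)` into
factors with nonnegative and nonpositive powers of `q` only. -/
lemma prod_nodes_below (ha : a ≠ 0) (hq0 : q ≠ 0) (j : ℕ) :
    (∏ i ∈ range j, (1 - a ^ 2 * q ^ (i + j)) * (1 - q ^ i / q ^ j)) * q ^ j =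
      a ^ (2 * j) * q ^ (j ^ 2) * (qPoch q q j * qPoch q (q ^ (-2 * (j : ℤ) + 1) / a ^ 2) j) := by
  have h1 : ∀ i ∈ range j, (1 - a ^ 2 * q ^ (i + j)) * (1 - q ^ i / q ^ j) =
      a ^ 2 * q ^ (2 * i) * ((1 - q * q ^ (j - 1 - i)) *
        (1 - q ^ (-2 * (j : ℤ) + 1) / a ^ 2 * q ^ (j - 1 - i))) := fun i hi => by
    obtain ⟨m, rfl⟩ : ∃ m, j = i + 1 + m := ⟨j - (i + 1), by rw [mem_range] at hi; omega⟩
    have e : q ^ (-2 * ((i + 1 + m : ℕ) : ℤ) + 1) = (q ^ (2 * i + 1 + 2 * m))⁻¹ := by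
      rw [← zpow_natCast, ← zpow_neg]
      congr 1
      push_cast
      ring
    rw [e, show i + 1 + m - 1 - i = m by omega]
    field_simp
    ring
  have h2 : ∀ j : ℕ, (∏ i ∈ range j, a ^ 2 * q ^ (2 * i)) * q ^ j = a ^ (2 * j) * q ^ (j ^ 2) := by
    intro j
    induction j with
    | zero => simp
    | succ j ih =>
      rw [prod_range_succ, show (j + 1) ^ 2 = j ^ 2 + (2 * j + 1) by ring, pow_add q]
      linear_combination a ^ 2 * q ^ (2 * j + 1) * ih
  rw [prod_congr rfl h1, prod_mul_distrib (f := fun i => a ^ 2 * q ^ (2 * i)),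
    prod_mul_distrib (f := fun i => 1 - q * q ^ (j - 1 - i)),
    prod_range_reflect (fun i => 1 - q * q ^ i) j,
    prod_range_reflect (fun i => 1 - q ^ (-2 * (j : ℤ) + 1) / a ^ 2 * q ^ i) j, ← h2 j, qPoch,
    qPoch]
  ring

/-- The denominators of the divided differences at the nodes, in terms of `q`-shifted factorials. -/
lemma prod_mul_prod_awNode (ha : a ≠ 0) (hq0 : q ≠ 0) {j k : ℕ} (hjk : j ≤ k) :
    (∏ i ∈ range k, (-2 * a * q ^ i)) *
        (∏ i ∈ (range (k + 1)).erase j, (awNode a q j - awNode a q i)) *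
        (q ^ k * (q ^ (-(j : ℤ) ^ 2) * a ^ (-2 * (j : ℤ)))) =
      qPoch q q j * qPoch q (q ^ (-2 * (j : ℤ) + 1) / a ^ 2) j *
        (qPoch q q (k - j) * qPoch q (q ^ (2 * j + 1) * a ^ 2) (k - j)) := by
  obtain ⟨m, rfl⟩ := Nat.exists_eq_add_of_le hjk
  rw [Nat.add_sub_cancel_left]
  have h1 : (∏ i ∈ range (j + m), (-2 * a * q ^ i)) * q ^ m =
      ∏ i ∈ (range (j + m + 1)).erase j, (-2 * a * q ^ i) := by
    have h := mul_prod_erase (range (j + m + 1)) (fun i => -2 * a * q ^ i)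
      (mem_range.2 (by omega : j < j + m + 1))
    rw [prod_range_succ] at h
    refine mul_left_cancel₀ (mul_ne_zero (mul_ne_zero (by norm_num : (-2 : ℂ) ≠ 0) ha)
      (pow_ne_zero j hq0)) ?_
    rw [h]
    ring
  have h2 : (∏ i ∈ (range (j + m + 1)).erase j, (-2 * a * q ^ i)) *
      (∏ i ∈ (range (j + m + 1)).erase j, (awNode a q j - awNode a q i)) =
      (∏ i ∈ range j, (1 - a ^ 2 * q ^ (i + j)) * (1 - q ^ i / q ^ j)) *
        (qPoch q q m * qPoch q (q ^ (2 * j + 1) * a ^ 2) m) := by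
    rw [← prod_mul_distrib, prod_congr rfl fun i _ => mul_awNode_sub_awNode ha hq0 i j,
      prod_range_erase, qPoch, qPoch, ← prod_mul_distrib (s := range m)]
    congr 1
    refine prod_congr rfl fun i _ => ?_
    field_simp
    ring
  have h3 := prod_nodes_below ha hq0 j
  have e1 : q ^ (-(j : ℤ) ^ 2) = (q ^ (j ^ 2))⁻¹ := by
    rw [← zpow_natCast, ← zpow_neg]
    push_cast
    rfl
  have e2 : a ^ (-2 * (j : ℤ)) = (a ^ (2 * j))⁻¹ := by
    rw [← zpow_natCast, ← zpow_neg]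
    push_cast
    rw [neg_mul]
  rw [e1, e2, pow_add]
  rw [← h1] at h2
  have hq2 := pow_ne_zero (j ^ 2) hq0
  have ha2 := pow_ne_zero (2 * j) ha
  generalize ∏ i ∈ range (j + m), (-2 * a * q ^ i) = E at *
  generalize ∏ i ∈ (range (j + m + 1)).erase j, (awNode a q j - awNode a q i) = T at *
  generalize qPoch q (q ^ (2 * j + 1) * a ^ 2) m = U at *
  generalize qPoch q (q ^ (-2 * (j : ℤ) + 1) / a ^ 2) j = V at *
  field_simp
  linear_combination q ^ j * h2 + (qPoch q q m * U) * h3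

end Nodes

/-! ### Moments -/

lemma awIntegral_polynomial {a b c d q : ℂ} (ha : a ≠ 0) (hq0 : q ≠ 0) (hq1 : ‖q‖ < 1)
    (habcd : ∀ m : ℕ, a * b * c * d * q ^ m ≠ 1)
    {C : ℝ → ℂ} (hC : IsAWContour a b c d q C) (p : ℂ[X]) (n : ℕ) (hp : p.natDegree ≤ n) :
    awIntegral a b c d q C (fun x => p.eval x) =
      ∑ k ∈ Finset.range (n + 1),
        qPoch q (a * b) k * qPoch q (a * c) k * qPoch q (a * d) k /
            qPoch q (a * b * c * d) k * q ^ k *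
          ∑ j ∈ Finset.range (k + 1),
            q ^ (-(j : ℤ) ^ 2) * a ^ (-2 * (j : ℤ)) *
              (p.eval ((q ^ j * a + q ^ (-(j : ℤ)) / a) / 2) /
                (qPoch q q j * qPoch q (q ^ (-2 * (j : ℤ) + 1) / a ^ 2) j *
                  (qPoch q q (k - j) * qPoch q (q ^ (2 * j + 1) * a ^ 2) (k - j)))) := by
  have hinj := injective_awNode ha hq0 hq1 (hC.param_mul_ne_one (e := a) (f := a)
    (by simp) (by simp))
  have hnodal : ∀ k, awIntegral a b c d q C
      (fun x => (Lagrange.nodal (Finset.range k) (awNode a q)).eval x) =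
      (∏ i ∈ Finset.range k, (-2 * a * q ^ i))⁻¹ * (qPoch q (a * b) k * qPoch q (a * c) k *
        qPoch q (a * d) k / qPoch q (a * b * c * d) k) := fun k => by
    have hne : ∏ i ∈ Finset.range k, (-2 * a * q ^ i) ≠ 0 :=
      Finset.prod_ne_zero_iff.2 fun i _ =>
        mul_ne_zero (mul_ne_zero (by norm_num) ha) (pow_ne_zero i hq0)
    have h := awIntegral_sum_mul hq1 hC {()} (fun _ => ∏ i ∈ Finset.range k, (-2 * a * q ^ i))
      fun _ => Lagrange.nodal (Finset.range k) (awNode a q)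
    simp only [Finset.sum_singleton] at h
    rw [eq_inv_mul_iff_mul_eq₀ hne, ← h]
    exact awIntegral_of_eq_qPoch hq0 hq1 habcd hC k
      fun z hz => qPoch_mul_qPoch_eq_nodal ha hq0 k hz
  have hnewton := eq_sum_divided_difference_mul_nodal hinj n p hp
  have heval : (fun x => p.eval x) = fun x => ∑ k ∈ Finset.range (n + 1),
      (∑ j ∈ Finset.range (k + 1), p.eval (awNode a q j) /
        ∏ i ∈ (Finset.range (k + 1)).erase j, (awNode a q j - awNode a q i)) *
          (Lagrange.nodal (Finset.range k) (awNode a q)).eval x := by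
    funext x
    conv_lhs => rw [hnewton]
    simp only [Polynomial.eval_finsetSum, Polynomial.eval_mul, Polynomial.eval_C]
  rw [heval, awIntegral_sum_mul hq1 hC]
  refine Finset.sum_congr rfl fun k _ => ?_
  have hk : (∑ j ∈ Finset.range (k + 1), p.eval (awNode a q j) /
        ∏ i ∈ (Finset.range (k + 1)).erase j, (awNode a q j - awNode a q i)) *
          (∏ i ∈ Finset.range k, (-2 * a * q ^ i))⁻¹ =
      q ^ k * ∑ j ∈ Finset.range (k + 1), q ^ (-(j : ℤ) ^ 2) * a ^ (-2 * (j : ℤ)) *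
        (p.eval ((q ^ j * a + q ^ (-(j : ℤ)) / a) / 2) /
          (qPoch q q j * qPoch q (q ^ (-2 * (j : ℤ) + 1) / a ^ 2) j *
            (qPoch q q (k - j) * qPoch q (q ^ (2 * j + 1) * a ^ 2) (k - j)))) := by
    rw [Finset.sum_mul, Finset.mul_sum]
    refine Finset.sum_congr rfl fun j hj => ?_
    have hu : q ^ k * (q ^ (-(j : ℤ) ^ 2) * a ^ (-2 * (j : ℤ))) ≠ 0 :=
      mul_ne_zero (pow_ne_zero k hq0) (mul_ne_zero (zpow_ne_zero _ hq0) (zpow_ne_zero _ ha))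
    rw [← prod_mul_prod_awNode ha hq0 (Nat.lt_succ_iff.1 (Finset.mem_range.1 hj)), ← mul_assoc,
      ← mul_div_assoc, mul_comm (_ * (_ * _)) (Polynomial.eval _ _), mul_div_mul_right _ _ hu,
      ← awNode, div_mul_eq_div_div_swap, div_eq_mul_inv (_ / _)]
  rw [hnodal, ← mul_assoc, hk]
  ring

theorem theorem1p6 (a b c d q : ℂ) (ha : a ≠ 0) (hq0 : q ≠ 0) (hq1 : ‖q‖ < 1)
    (habcd : ∀ m : ℕ, a * b * c * d * q ^ m ≠ 1)
    (C : ℝ → ℂ) (hC : IsAWContour a b c d q C) :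
    (∀ n : ℕ, awMoment a b c d q C n =
      1 / 2 ^ n * ∑ k ∈ Finset.range (n + 1),
        qPoch q (a * b) k * qPoch q (a * c) k * qPoch q (a * d) k /
            qPoch q (a * b * c * d) k * q ^ k *
          ∑ j ∈ Finset.range (k + 1),
            q ^ (-(j : ℤ) ^ 2) * a ^ (-2 * (j : ℤ)) *
              ((q ^ j * a + q ^ (-(j : ℤ)) / a) ^ n /
                (qPoch q q j * qPoch q (q ^ (-2 * (j : ℤ) + 1) / a ^ 2) j *
                  (qPoch q q (k - j) * qPoch q (q ^ (2 * j + 1) * a ^ 2) (k - j))))) ∧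
    (∀ (p : ℂ[X]) (n : ℕ), p.natDegree ≤ n →
      awIntegral a b c d q C (fun x => p.eval x) =
      ∑ k ∈ Finset.range (n + 1),
        qPoch q (a * b) k * qPoch q (a * c) k * qPoch q (a * d) k /
            qPoch q (a * b * c * d) k * q ^ k *
          ∑ j ∈ Finset.range (k + 1),
            q ^ (-(j : ℤ) ^ 2) * a ^ (-2 * (j : ℤ)) *
              (p.eval ((q ^ j * a + q ^ (-(j : ℤ)) / a) / 2) /
                (qPoch q q j * qPoch q (q ^ (-2 * (j : ℤ) + 1) / a ^ 2) j *
                  (qPoch q q (k - j) * qPoch q (q ^ (2 * j + 1) * a ^ 2) (k - j))))) := by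
  refine ⟨fun n => ?_, awIntegral_polynomial ha hq0 hq1 habcd hC⟩
  have h := awIntegral_polynomial ha hq0 hq1 habcd hC (Polynomial.X ^ n) n
    (Polynomial.natDegree_X_pow n).le
  simp only [Polynomial.eval_pow, Polynomial.eval_X] at h
  rw [awMoment, h, Finset.mul_sum]
  refine Finset.sum_congr rfl fun k _ => ?_
  rw [mul_left_comm (1 / 2 ^ n : ℂ)]
  congr 1
  rw [Finset.mul_sum]
  refine Finset.sum_congr rfl fun j _ => ?_
  rw [div_pow]
  ring
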